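/- Let $k\ge 2$ and let $S$ be the compactified star graph obtained from $k$ copies $\{i\}\times[0,\infty]$, $i=1,\dots,k$, of $[0,\infty]$ by identifying all left ends $(i,0)$ with a single point $\mathfrak 0$. Let $C(S)$ be the space of real continuous functions on $S$ with the supremum norm, and write $g_i(x)=g(i,x)$. For $\lambda>0$ and $g\in C(S)$ put $$(R^0_\lambda g)_i(x)=\tfrac1{\sqrt{2\lambda}}\int_0^\infty\big(e^{-\sqrt{2\lambda}|x-y|}-e^{-\sqrt{2\lambda}(x+y)}\big)g_i(y)\,dy,\quad 0\le x<\infty,\qquad (R^0_\lambda g)_i(\infty)=\tfrac{g_i(\infty)}{\lambda},$$ $(\ell^0_\lambda)_i(x)=e^{-\sqrt{2\lambda}x}$ (with $(\ell_\lambda^0)_i(\infty)=0$), and $C_i(g)=\frac1{\sqrt{2\lambda}}\int_0^\infty e^{-\sqrt{2\lambda}y}g_i(y)\,dy$. For nonnegative $\alpha,\beta_1,\dots,\beta_k,\gamma$ and a finite Borel measure $m$ on $S$ consider the resolvent formula $$R_\lambda g=R^0_\lambda g+\frac{\int_S R^0_\lambda g\,dm+C(g)}{\gamma+\lambda\int_S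 R^0_\lambda 1_S\,dm+\lambda C(1_S)}\,\ell^0_\lambda,\qquad C(g)=2\sqrt{2\lambda}\sum_i\beta_iC_i(g)+\alpha g(\mathfrak 0).$$ Assume that $\alpha+\sum_i\beta_i=0$ and that $m=\delta\mu$, where $\delta>0$ and $\mu$ is a Borel probability measure on $S$ with no mass at $\mathfrak 0$ or at any of the points $(i,\infty)$. Let $F(g)=\delta\int_S g\,d\mu-(\gamma+\delta)g(\mathfrak 0)$ and $C_F(S)=\{g\in C(S):F(g)=0\}$. Then: 1. $R_\lambda$, $\lambda>0$, are nonnegative operators in $C(S)$ that satisfy the Hilbert equation $(\lambda-\nu)R_\nu R_\lambda=R_\nu-R_\lambda$ and $\lambda R_\lambda 1_S\le 1_S$, but they do not form a Feller resolvent, that is, it is not true that $\lim_{\lambda\to\infty}\lambda R_\lambda g=g$ in $C(S)$ for every $g\in C(S)$. Moreover, $R_\lambda g\in C_F(S)$ for all $\lambda>0$ and $g\in C(S)$. 2. There is exactly one strongly continuous semigroup $(T(t))_{t\ge0}$ of positive contractions in $C_F(S)$ such that $$R_\lambda g=\int_0^\infty e^{-\lambda t}T(t)g\,dt,\qquad \lambda>0,\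 g\in C_F(S).$$ 3. This semigroup is conservative, that is, $1_S\in C_F(S)$ and $T(t)1_S=1_S$ for all $t\ge 0$, if and only if $\gamma=0$. -/

import Mathlib

open Set Filter Topology MeasureTheory
open scoped NNReal ENNReal

noncomputable section

/-! ### The compactified star graph -/

/-- Identification of the left ends of `k` copies of `[0, ∞]`. -/
def starSetoid (k : ℕ) : Setoid (Fin k × ℝ≥0∞) where
  r p q := p = q ∨ (p.2 = 0 ∧ q.2 = 0)
  iseqv :=
    { refl := fun _ => Or.inl rfl
      symm := by
        rintro p q (h | h)
        · exact Or.inl h.symm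
        · exact Or.inr h.symm
      trans := by
        rintro p q r (rfl | h) (rfl | h')
        · exact Or.inl rfl
        · exact Or.inr h'
        · exact Or.inr h
        · exact Or.inr ⟨h.1, h'.2⟩ }

/-- The star graph with `k` edges: `k` copies of the compactified half-line `[0, ∞]` with all left
ends identified (quotient topology). -/
def StarGraph (k : ℕ) : Type := Quotient (starSetoid k)

namespace StarGraph

variable {k : ℕ}

instance : TopologicalSpace (StarGraph k) :=
  inferInstanceAs (TopologicalSpace (Quotient (starSetoid k)))

instance : CompactSpace (StarGraph k) :=
  inferInstanceAs (CompactSpace (Quotient (starSetoid k)))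

instance : MeasurableSpace (StarGraph k) := borel _

instance : BorelSpace (StarGraph k) := ⟨rfl⟩

/-- The point `x ∈ [0, ∞]` of the `i`-th edge. -/
def mk (i : Fin k) (x : ℝ≥0∞) : StarGraph k := Quotient.mk (starSetoid k) (i, x)

/-- The center of the graph. -/
def center [NeZero k] : StarGraph k := mk 0 0

theorem continuous_mk (i : Fin k) : Continuous (mk i) :=
  (continuous_quotient_mk' (s := starSetoid k)).comp (by fun_prop)

theorem mk_zero (i j : Fin k) : mk i 0 = mk j 0 :=
  Quotient.sound (Or.inr ⟨rfl, rfl⟩)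

theorem mk_zero_eq_center [NeZero k] (i : Fin k) : mk i 0 = center := mk_zero _ _

theorem exists_mk (s : StarGraph k) : ∃ i x, mk i x = s := by
  induction s using Quotient.inductionOn with
  | h p => exact ⟨p.1, p.2, rfl⟩

/-- Continuous functions on the graph are the families `(f_i)` of continuous functions on `[0, ∞]`
with a common value at `0`. -/
def ofEdges (f : Fin k → ℝ≥0∞ → ℝ) (hf : ∀ i, Continuous (f i)) (h0 : ∀ i j, f i 0 = f j 0) :
    C(StarGraph k, ℝ) where
  toFun := Quotient.lift (fun p : Fin k × ℝ≥0∞ => f p.1 p.2) (by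
    rintro ⟨i, x⟩ ⟨j, y⟩ (h | ⟨h, h'⟩)
    · rw [h]
    · simp only at h h' ⊢
      rw [h, h', h0 i j])
  continuous_toFun := by
    refine Continuous.quotient_lift ?_ _
    exact continuous_prod_of_discrete_left.2 fun i => hf i

theorem ofEdges_mk (f : Fin k → ℝ≥0∞ → ℝ) (hf : ∀ i, Continuous (f i))
    (h0 : ∀ i j, f i 0 = f j 0) (i : Fin k) (x : ℝ≥0∞) : ofEdges f hf h0 (mk i x) = f i x := rfl

/-- The function on `[0, ∞]` equal to `f` on `[0, ∞)` and to `L` at `∞`. -/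
def extendTop (f : ℝ → ℝ) (L : ℝ) (x : ℝ≥0∞) : ℝ := if x = ⊤ then L else f x.toReal

theorem continuous_extendTop {f : ℝ → ℝ} {L : ℝ} (hf : Continuous f)
    (hL : Tendsto f atTop (𝓝 L)) : Continuous (extendTop f L) := by
  rw [continuous_iff_continuousAt]
  intro x
  by_cases hx : x = ⊤
  · subst hx
    rw [ContinuousAt, Metric.tendsto_nhds]
    intro ε hε
    obtain ⟨N, hN⟩ := eventually_atTop.1 (Metric.tendsto_nhds.1 hL ε hε)
    filter_upwards [lt_mem_nhds (ENNReal.ofReal_lt_top (r := N))] with y hy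
    by_cases hy' : y = ⊤
    · simp [hy', hε]
    · have : N ≤ y.toReal := (ENNReal.ofReal_le_iff_le_toReal hy').1 hy.le
      simpa [extendTop, hy'] using hN _ this
  · have h1 : ContinuousAt (fun y : ℝ≥0∞ => f y.toReal) x :=
      hf.continuousAt.comp (ENNReal.continuousAt_toReal hx)
    refine h1.congr ?_
    filter_upwards [isOpen_ne.mem_nhds hx] with y hy
    simp only [extendTop, if_neg (show y ≠ ⊤ from hy)]

/-- The restriction `g_i` of `g` to the `i`-th edge, as a function of a real variable
(only its values on `[0, ∞)` matter). -/
def edge (g : C(StarGraph k, ℝ)) (i : Fin k) (y : ℝ) : ℝ := g (mk i (ENNReal.ofReal y))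

theorem continuous_edge (g : C(StarGraph k, ℝ)) (i : Fin k) : Continuous (edge g i) :=
  g.continuous.comp ((continuous_mk i).comp ENNReal.continuous_ofReal)

theorem abs_edge_le (g : C(StarGraph k, ℝ)) (i : Fin k) (y : ℝ) : |edge g i y| ≤ ‖g‖ :=
  g.norm_coe_le_norm _

theorem tendsto_edge (g : C(StarGraph k, ℝ)) (i : Fin k) :
    Tendsto (edge g i) atTop (𝓝 (g (mk i ⊤))) :=
  ((g.continuous.comp (continuous_mk i)).tendsto ⊤).comp ENNReal.tendsto_ofReal_atTop

/-! ### The minimal Brownian motion -/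

/-- The resolvent of the minimal (killed at the origin) Brownian motion on the half-line:
`x ↦ (2λ)^{-1/2} ∫_0^∞ (e^{-√(2λ)|x-y|} - e^{-√(2λ)(x+y)}) e(y) dy`. -/
def minResHalfLine (lam : ℝ) (e : ℝ → ℝ) (x : ℝ) : ℝ :=
  1 / √(2 * lam) * ∫ y in Ioi (0 : ℝ),
    (Real.exp (-√(2 * lam) * |x - y|) - Real.exp (-√(2 * lam) * (x + y))) * e y

theorem integrable_exp_neg_abs {a : ℝ} (ha : 0 < a) :
    Integrable (fun z : ℝ => Real.exp (-a * |z|)) := by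
  rw [← integrableOn_univ, ← Iic_union_Ioi (a := (0 : ℝ))]
  refine IntegrableOn.union ?_ ?_
  · refine (integrableOn_exp_mul_Iic ha 0).congr_fun (fun z hz => ?_) measurableSet_Iic
    simp [abs_of_nonpos (show z ≤ 0 from hz)]
  · refine (integrableOn_exp_mul_Ioi (neg_neg_iff_pos.2 ha) 0).congr_fun (fun z hz => ?_)
      measurableSet_Ioi
    simp [abs_of_pos (show 0 < z from hz)]

theorem integral_exp_neg_abs {a : ℝ} (ha : 0 < a) :
    ∫ z : ℝ, Real.exp (-a * |z|) = 2 / a := by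
  rw [integral_comp_abs (f := fun z => Real.exp (-a * z)),
    integral_exp_mul_Ioi (neg_neg_iff_pos.2 ha) 0]
  simp [div_eq_mul_inv]

theorem integrable_exp_abs_mul {a : ℝ} (ha : 0 < a) {e : ℝ → ℝ} (he : Continuous e) {M : ℝ}
    (hM : ∀ y, |e y| ≤ M) (x : ℝ) :
    IntegrableOn (fun y => Real.exp (-a * |x - y|) * e y) (Ioi 0) := by
  have h := (integrable_exp_neg_abs ha).comp_sub_left x
  exact (h.mul_bdd (c := M) he.aestronglyMeasurable (ae_of_all _ hM)).integrableOn

theorem integrable_exp_add_mul {a : ℝ} (ha : 0 < a) {e : ℝ → ℝ} (he : Continuous e) {M : ℝ}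
    (hM : ∀ y, |e y| ≤ M) (x : ℝ) :
    IntegrableOn (fun y => Real.exp (-a * (x + y)) * e y) (Ioi 0) := by
  have h : IntegrableOn (fun y => Real.exp (-a * (x + y))) (Ioi 0) := by
    have := (integrableOn_exp_mul_Ioi (neg_neg_iff_pos.2 ha) 0).const_mul (Real.exp (-a * x))
    refine IntegrableOn.congr_fun this (fun y _ => ?_) measurableSet_Ioi
    rw [← Real.exp_add]; ring_nf
  exact h.mul_bdd (c := M) he.aestronglyMeasurable (ae_of_all _ hM)

theorem integrable_kernel {a : ℝ} (ha : 0 < a) {e : ℝ → ℝ} (he : Continuous e) {M : ℝ}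
    (hM : ∀ y, |e y| ≤ M) (x : ℝ) :
    IntegrableOn (fun y => (Real.exp (-a * |x - y|) - Real.exp (-a * (x + y))) * e y) (Ioi 0) := by
  simp only [sub_mul]
  exact (integrable_exp_abs_mul ha he hM x).sub (integrable_exp_add_mul ha he hM x)

theorem minResHalfLine_eq {lam : ℝ} (hl : 0 < lam) {e : ℝ → ℝ} (he : Continuous e) {M : ℝ}
    (hM : ∀ y, |e y| ≤ M) (x : ℝ) :
    minResHalfLine lam e x = 1 / √(2 * lam) *
      ((∫ z, Real.exp (-√(2 * lam) * |z|) * (Ioi (0 : ℝ)).indicator e (x + z))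
        - Real.exp (-√(2 * lam) * x) * ∫ y in Ioi (0 : ℝ), Real.exp (-√(2 * lam) * y) * e y) := by
  have ha : 0 < √(2 * lam) := by positivity
  unfold minResHalfLine
  congr 1
  simp only [sub_mul]
  rw [integral_sub (integrable_exp_abs_mul ha he hM x) (integrable_exp_add_mul ha he hM x)]
  congr 1
  · rw [← integral_indicator measurableSet_Ioi,
      ← integral_add_left_eq_self (μ := volume) _ x]
    congr 1
    ext z
    by_cases hz : 0 < x + z
    · simp [indicator, hz]
    · simp [indicator, hz]
  · rw [← integral_const_mul]
    congr 1
    ext y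
    rw [← mul_assoc, ← Real.exp_add]
    ring_nf

theorem tendsto_shift {a : ℝ} (ha : 0 < a) {e : ℝ → ℝ} (he : Continuous e) {M : ℝ}
    (hM : ∀ y, |e y| ≤ M) {l : Filter ℝ} [l.IsCountablyGenerated] {G : ℝ → ℝ}
    (h : ∀ᵐ z, Tendsto (fun x => (Ioi (0 : ℝ)).indicator e (x + z)) l (𝓝 (G z))) :
    Tendsto (fun x => ∫ z, Real.exp (-a * |z|) * (Ioi (0 : ℝ)).indicator e (x + z)) l
      (𝓝 (∫ z, Real.exp (-a * |z|) * G z)) := by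
  have hM0 : 0 ≤ M := (abs_nonneg _).trans (hM 0)
  refine tendsto_integral_filter_of_dominated_convergence
    (fun z => Real.exp (-a * |z|) * M) ?_ ?_ ((integrable_exp_neg_abs ha).mul_const M) ?_
  · refine Eventually.of_forall fun x => ?_
    refine (Continuous.aestronglyMeasurable (by fun_prop)).mul ?_
    exact ((he.measurable.indicator measurableSet_Ioi).comp
      (measurable_const_add x)).aestronglyMeasurable
  · refine Eventually.of_forall fun x => ae_of_all _ fun z => ?_
    rw [norm_mul, Real.norm_of_nonneg (Real.exp_pos _).le]
    gcongr
    exact (norm_indicator_le_norm_self _ _).trans (hM _)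
  · filter_upwards [h] with z hz using hz.const_mul _

theorem continuous_minResHalfLine {lam : ℝ} (hl : 0 < lam) {e : ℝ → ℝ} (he : Continuous e) {M : ℝ}
    (hM : ∀ y, |e y| ≤ M) : Continuous (minResHalfLine lam e) := by
  have ha : 0 < √(2 * lam) := by positivity
  rw [funext (minResHalfLine_eq hl he hM)]
  refine continuous_const.mul (Continuous.sub ?_ (by fun_prop))
  rw [continuous_iff_continuousAt]
  intro x
  refine tendsto_shift ha he hM ?_
  have hz : ∀ᵐ z : ℝ, z ≠ -x := by simp [ae_iff]
  filter_upwards [hz] with z hz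
  have h1 : ContinuousAt ((Ioi (0 : ℝ)).indicator e) (x + z) := by
    rcases lt_or_gt_of_ne (show x + z ≠ 0 from fun h => hz (by linarith)) with h | h
    · refine (continuousAt_const (y := (0 : ℝ))).congr ?_
      filter_upwards [Iio_mem_nhds h] with y hy
      simp [indicator, not_lt.2 (le_of_lt (show y < 0 from hy))]
    · refine he.continuousAt.congr ?_
      filter_upwards [Ioi_mem_nhds h] with y hy
      simp [indicator, show 0 < y from hy]
  exact h1.tendsto.comp ((continuous_id.add continuous_const).tendsto' _ _ rfl)

theorem tendsto_minResHalfLine {lam : ℝ} (hl : 0 < lam) {e : ℝ → ℝ} (he : Continuous e) {M : ℝ}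
    (hM : ∀ y, |e y| ≤ M) {L : ℝ} (hL : Tendsto e atTop (𝓝 L)) :
    Tendsto (minResHalfLine lam e) atTop (𝓝 (L / lam)) := by
  have ha : 0 < √(2 * lam) := by positivity
  rw [funext (minResHalfLine_eq hl he hM)]
  have h1 : Tendsto (fun x => ∫ z, Real.exp (-√(2 * lam) * |z|) *
      (Ioi (0 : ℝ)).indicator e (x + z)) atTop
      (𝓝 (∫ z, Real.exp (-√(2 * lam) * |z|) * L)) := by
    refine tendsto_shift ha he hM (ae_of_all _ fun z => ?_)
    have hz : Tendsto (fun x : ℝ => x + z) atTop atTop := tendsto_atTop_add_const_right _ _ tendsto_id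
    refine (hL.comp hz).congr' ?_
    filter_upwards [hz.eventually_gt_atTop 0] with x hx
    simp [indicator, hx]
  have h2 : Tendsto (fun x => Real.exp (-√(2 * lam) * x)) atTop (𝓝 0) :=
    Real.tendsto_exp_atBot.comp (tendsto_id.const_mul_atTop_of_neg (neg_neg_iff_pos.2 ha))
  have h3 := (h1.sub (h2.mul_const
    (∫ y in Ioi (0 : ℝ), Real.exp (-√(2 * lam) * y) * e y))).const_mul (1 / √(2 * lam))
  convert h3 using 2
  rw [integral_mul_const, integral_exp_neg_abs ha]
  have hsq : √(2 * lam) * √(2 * lam) = 2 * lam := Real.mul_self_sqrt (by positivity)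
  have h4 : 1 / √(2 * lam) * (2 / √(2 * lam) * L - 0) = 2 * L / (√(2 * lam) * √(2 * lam)) := by
    field_simp
    ring
  rw [zero_mul, h4, hsq]
  field_simp

theorem abs_minResHalfLine_le {lam : ℝ} (hl : 0 < lam) {e : ℝ → ℝ} {M : ℝ}
    (hM : ∀ y, |e y| ≤ M) {x : ℝ} (hx : 0 ≤ x) :
    |minResHalfLine lam e x| ≤ 1 / lam * M := by
  have ha : 0 < √(2 * lam) := by positivity
  have hM0 : 0 ≤ M := (abs_nonneg _).trans (hM 0)
  have h0 : |∫ y in Ioi (0 : ℝ), (Real.exp (-√(2 * lam) * |x - y|)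
      - Real.exp (-√(2 * lam) * (x + y))) * e y| ≤ 2 / √(2 * lam) * M := by
    have hi := ((integrable_exp_neg_abs ha).comp_sub_left x).mul_const M
    calc _ ≤ ∫ y in Ioi (0 : ℝ), Real.exp (-√(2 * lam) * |x - y|) * M := by
          rw [← Real.norm_eq_abs]
          refine norm_integral_le_of_norm_le hi.integrableOn ?_
          filter_upwards [ae_restrict_mem measurableSet_Ioi] with y hy
          have hy : 0 < y := hy
          rw [norm_mul]
          refine mul_le_mul ?_ (hM y) (norm_nonneg _) (Real.exp_pos _).le
          have h1 : |x - y| ≤ x + y := abs_le.2 ⟨by linarith, by linarith⟩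
          have h2 : Real.exp (-√(2 * lam) * (x + y)) ≤ Real.exp (-√(2 * lam) * |x - y|) :=
            Real.exp_le_exp.2 (by nlinarith)
          rw [Real.norm_of_nonneg (by linarith)]
          linarith [Real.exp_pos (-√(2 * lam) * (x + y))]
      _ ≤ ∫ y, Real.exp (-√(2 * lam) * |x - y|) * M :=
          setIntegral_le_integral hi (ae_of_all _ fun y => by positivity)
      _ = 2 / √(2 * lam) * M := by
          rw [integral_mul_const,
            integral_sub_left_eq_self (fun z => Real.exp (-√(2 * lam) * |z|)) volume x,
            integral_exp_neg_abs ha]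
  have hsq : √(2 * lam) * √(2 * lam) = 2 * lam := Real.mul_self_sqrt (by positivity)
  have h4 : 1 / lam * M = 1 / √(2 * lam) * (2 / √(2 * lam) * M) := by
    have h5 : 1 / √(2 * lam) * (2 / √(2 * lam) * M) = 2 * M / (√(2 * lam) * √(2 * lam)) := by
      field_simp
    rw [h5, hsq]
    field_simp
  rw [minResHalfLine, abs_mul, abs_of_pos (by positivity), h4]
  gcongr

theorem minResHalfLine_zero (lam : ℝ) (e : ℝ → ℝ) : minResHalfLine lam e 0 = 0 := by
  unfold minResHalfLine
  rw [setIntegral_congr_fun (g := fun _ => (0 : ℝ)) measurableSet_Ioi]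
  · simp
  · intro y hy
    simp [abs_of_pos (show (0 : ℝ) < y from hy)]

/-- The resolvent `R⁰_λ`, `λ > 0`, of the minimal Brownian motion on the star graph: on each edge
it is the resolvent on the half-line, extended by continuity to the points at infinity, where its
value is `g_i(∞) / λ`. (Junk value `0` for `λ ≤ 0`.) -/
def minRes (lam : ℝ) : C(StarGraph k, ℝ) →L[ℝ] C(StarGraph k, ℝ) :=
  if h : 0 < lam then
    LinearMap.mkContinuous
      { toFun := fun g =>
          ofEdges (fun i => extendTop (minResHalfLine lam (edge g i)) (g (mk i ⊤) / lam))
            (fun i => continuous_extendTop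
              (continuous_minResHalfLine h (continuous_edge g i) (abs_edge_le g i))
              (tendsto_minResHalfLine h (continuous_edge g i) (abs_edge_le g i)
                (tendsto_edge g i)))
            (fun i j => by simp [extendTop, minResHalfLine_zero])
        map_add' := fun f g => by
          ext s
          obtain ⟨i, x, rfl⟩ := exists_mk s
          simp only [ofEdges_mk, ContinuousMap.add_apply, extendTop]
          split_ifs
          · ring
          · have ha : 0 < √(2 * lam) := by positivity
            have h1 := integrable_kernel ha (continuous_edge f i) (abs_edge_le f i) x.toReal
            have h2 := integrable_kernel ha (continuous_edge g i) (abs_edge_le g i) x.toReal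
            simp only [minResHalfLine]
            rw [← mul_add, ← integral_add h1 h2]
            simp only [edge, ContinuousMap.add_apply, mul_add]
        map_smul' := fun c g => by
          ext s
          obtain ⟨i, x, rfl⟩ := exists_mk s
          simp only [ofEdges_mk, ContinuousMap.smul_apply, extendTop, smul_eq_mul,
            RingHom.id_apply]
          split_ifs
          · ring
          · simp only [minResHalfLine]
            rw [mul_left_comm c, ← integral_const_mul c]
            simp only [edge, ContinuousMap.smul_apply, smul_eq_mul, mul_left_comm _ c] }
      (1 / lam) (fun g => by
        refine (ContinuousMap.norm_le _ (by positivity)).2 fun s => ?_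
        obtain ⟨i, x, rfl⟩ := exists_mk s
        simp only [LinearMap.coe_mk, AddHom.coe_mk, ofEdges_mk, extendTop]
        split_ifs
        · rw [norm_div, Real.norm_of_nonneg h.le, div_eq_inv_mul, one_div]
          gcongr
          exact g.norm_coe_le_norm _
        · exact abs_minResHalfLine_le h (abs_edge_le g i) ENNReal.toReal_nonneg)
  else 0

theorem minRes_apply {lam : ℝ} (h : 0 < lam) (g : C(StarGraph k, ℝ)) (i : Fin k) (x : ℝ≥0∞) :
    minRes lam g (mk i x) =
      if x = ⊤ then g (mk i ⊤) / lam else minResHalfLine lam (edge g i) x.toReal := by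
  rw [minRes, dif_pos h]
  rfl

/-- The Laplace transform `ℓ⁰_λ`, `λ > 0`, of the lifetime of the minimal Brownian motion:
`(i, x) ↦ e^{-√(2λ) x}`, which is `0` at the points at infinity. (Junk value `0` for `λ ≤ 0`.) -/
def lifetimeLaplace (lam : ℝ) : C(StarGraph k, ℝ) :=
  if h : 0 < lam then
    ofEdges (fun _ => extendTop (fun x => Real.exp (-√(2 * lam) * x)) 0)
      (fun _ => continuous_extendTop (by fun_prop)
        (Real.tendsto_exp_atBot.comp
          (tendsto_id.const_mul_atTop_of_neg (neg_neg_iff_pos.2 (by positivity)))))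
      (fun _ _ => rfl)
  else 0

theorem lifetimeLaplace_apply {lam : ℝ} (h : 0 < lam) (i : Fin k) (x : ℝ≥0∞) :
    lifetimeLaplace lam (mk i x) =
      if x = ⊤ then 0 else Real.exp (-√(2 * lam) * x.toReal) := by
  rw [lifetimeLaplace, dif_pos h]
  rfl

/-! ### The resolvent formula -/

/-- `C_i(g) = (2λ)^{-1/2} ∫_0^∞ e^{-√(2λ) y} g_i(y) dy`, for `λ > 0`. (Junk value `0` for
`λ ≤ 0`.) -/
def edgeLaplace (lam : ℝ) (i : Fin k) : C(StarGraph k, ℝ) →L[ℝ] ℝ :=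
  if h : 0 < lam then
    LinearMap.mkContinuous
      { toFun := fun g => 1 / √(2 * lam) *
          ∫ y in Ioi (0 : ℝ), Real.exp (-√(2 * lam) * y) * edge g i y
        map_add' := fun f g => by
          have ha : 0 < √(2 * lam) := by positivity
          have h1 := integrable_exp_add_mul ha (continuous_edge f i) (abs_edge_le f i) 0
          have h2 := integrable_exp_add_mul ha (continuous_edge g i) (abs_edge_le g i) 0
          simp only [zero_add] at h1 h2
          rw [← mul_add, ← integral_add h1 h2]
          simp only [edge, ContinuousMap.add_apply, mul_add]
        map_smul' := fun c g => by
          rw [RingHom.id_apply, smul_eq_mul, mul_left_comm c, ← integral_const_mul c]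
          simp only [edge, ContinuousMap.smul_apply, smul_eq_mul, mul_left_comm _ c] }
      (1 / √(2 * lam) * ∫ y in Ioi (0 : ℝ), Real.exp (-√(2 * lam) * y)) (fun g => by
        have ha : 0 < √(2 * lam) := by positivity
        simp only [LinearMap.coe_mk, AddHom.coe_mk]
        rw [norm_mul, Real.norm_of_nonneg (by positivity), mul_assoc, ← integral_mul_const]
        gcongr
        refine norm_integral_le_of_norm_le
          ((integrableOn_exp_mul_Ioi (neg_neg_iff_pos.2 ha) 0).mul_const _) (ae_of_all _ fun y => ?_)
        rw [norm_mul, Real.norm_of_nonneg (Real.exp_pos _).le]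
        gcongr
        exact abs_edge_le g i y)
  else 0

theorem edgeLaplace_apply {lam : ℝ} (h : 0 < lam) (i : Fin k) (g : C(StarGraph k, ℝ)) :
    edgeLaplace lam i g =
      1 / √(2 * lam) * ∫ y in Ioi (0 : ℝ), Real.exp (-√(2 * lam) * y) * edge g i y := by
  rw [edgeLaplace, dif_pos h]
  rfl

theorem integrable_of_continuous (m : Measure (StarGraph k)) [IsFiniteMeasure m]
    (g : C(StarGraph k, ℝ)) : Integrable g m :=
  (integrable_const ‖g‖).mono' g.continuous.aestronglyMeasurable
    (ae_of_all _ g.norm_coe_le_norm)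

/-- The functional `g ↦ ∫ g dm` for a finite Borel measure `m`. -/
def integralFunctional (m : Measure (StarGraph k)) [IsFiniteMeasure m] :
    C(StarGraph k, ℝ) →L[ℝ] ℝ :=
  LinearMap.mkContinuous
    { toFun := fun g => ∫ s, g s ∂m
      map_add' := fun f g => integral_add (integrable_of_continuous m f)
        (integrable_of_continuous m g)
      map_smul' := fun c g => integral_const_mul c _ }
    (m.real univ) (fun g => by
      rw [mul_comm]
      exact norm_integral_le_of_norm_le_const (ae_of_all _ g.norm_coe_le_norm))

theorem integralFunctional_apply (m : Measure (StarGraph k)) [IsFiniteMeasure m]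
    (g : C(StarGraph k, ℝ)) : integralFunctional m g = ∫ s, g s ∂m := rfl

/-- `C(g) = 2 √(2λ) ∑ β_i C_i(g) + α g(0)`. -/
def boundaryFunctional [NeZero k] (α : ℝ) (β : Fin k → ℝ) (lam : ℝ) : C(StarGraph k, ℝ) →L[ℝ] ℝ :=
  (2 * √(2 * lam)) • ∑ i, β i • edgeLaplace lam i + α • ContinuousMap.evalCLM ℝ center

/-- The functional
`g ↦ (∫ R⁰_λ g dm + C(g)) / (γ + λ ∫ R⁰_λ 1 dm + λ C(1))`. -/
def entranceFunctional [NeZero k] (α : ℝ) (β : Fin k → ℝ) (γ : ℝ) (m : Measure (StarGraph k))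
    [IsFiniteMeasure m] (lam : ℝ) : C(StarGraph k, ℝ) →L[ℝ] ℝ :=
  (γ + lam * ∫ s, (minRes lam (1 : C(StarGraph k, ℝ))) s ∂m
      + lam * boundaryFunctional α β lam 1)⁻¹ •
    ((integralFunctional m).comp (minRes lam) + boundaryFunctional α β lam)

/-- The resolvent formula `R_λ g = R⁰_λ g + C̄(g) ℓ⁰_λ`, `λ > 0`, with parameters `α, β, γ` and a
finite measure `m`. -/
def resolventFormula [NeZero k] (α : ℝ) (β : Fin k → ℝ) (γ : ℝ) (m : Measure (StarGraph k))
    [IsFiniteMeasure m] (lam : ℝ) : C(StarGraph k, ℝ) →L[ℝ] C(StarGraph k, ℝ) :=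
  minRes lam + (entranceFunctional α β γ m lam).smulRight (lifetimeLaplace lam)

theorem resolventFormula_apply [NeZero k] (α : ℝ) (β : Fin k → ℝ) (γ : ℝ)
    (m : Measure (StarGraph k)) [IsFiniteMeasure m] (lam : ℝ) (g : C(StarGraph k, ℝ)) :
    resolventFormula α β γ m lam g =
      minRes lam g + entranceFunctional α β γ m lam g • lifetimeLaplace lam := rfl

/-- The functional `F g = δ ∫ g dμ - (γ + δ) g(0)`. -/
def kernelFunctional [NeZero k] (γ : ℝ) (δ : ℝ≥0) (μ : Measure (StarGraph k)) [IsFiniteMeasure μ] :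
    C(StarGraph k, ℝ) →L[ℝ] ℝ :=
  (δ : ℝ) • integralFunctional μ - (γ + δ) • ContinuousMap.evalCLM ℝ center

/-- The kernel of the functional `F`, a closed subspace of `C(S)`. -/
abbrev kernelSpace [NeZero k] (γ : ℝ) (δ : ℝ≥0) (μ : Measure (StarGraph k)) [IsFiniteMeasure μ] :
    Submodule ℝ C(StarGraph k, ℝ) :=
  LinearMap.ker (kernelFunctional γ δ μ).toLinearMap

end StarGraph

/-! ### Resolvents and semigroups on spaces of continuous functions -/

section Semigroups

variable {X : Type*} [TopologicalSpace X] [CompactSpace X]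

/-- A sub-Markov pseudo-resolvent in `C(X)`: nonnegative operators `R_λ`, `λ > 0`, that satisfy the
Hilbert equation and `λ R_λ 1 ≤ 1`. -/
structure IsSubMarkovPseudoResolvent (R : ℝ → C(X, ℝ) →L[ℝ] C(X, ℝ)) : Prop where
  nonneg : ∀ lam, 0 < lam → ∀ f : C(X, ℝ), 0 ≤ f → 0 ≤ R lam f
  hilbert : ∀ lam nu, 0 < lam → 0 < nu → (lam - nu) • (R nu ∘L R lam) = R nu - R lam
  le_one : ∀ lam, 0 < lam → lam • R lam 1 ≤ 1

/-- A Feller resolvent in `C(X)`. -/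
structure IsFellerResolvent (R : ℝ → C(X, ℝ) →L[ℝ] C(X, ℝ)) : Prop
    extends IsSubMarkovPseudoResolvent R where
  tendsto : ∀ f : C(X, ℝ), Tendsto (fun lam : ℝ => lam • R lam f) atTop (𝓝 f)

/-- A strongly continuous semigroup of positive contractions in a subspace `E` of `C(X)`. -/
structure IsPositiveContractionSemigroup {E : Submodule ℝ C(X, ℝ)} (T : ℝ≥0 → E →L[ℝ] E) :
    Prop where
  zero : T 0 = ContinuousLinearMap.id ℝ E
  add : ∀ s t, T (s + t) = T s ∘L T t
  continuous : ∀ g, Continuous fun t => T t g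
  nonneg : ∀ t (g : E), 0 ≤ (g : C(X, ℝ)) → 0 ≤ (T t g : C(X, ℝ))
  contraction : ∀ t (g : E), ‖T t g‖ ≤ ‖g‖

/-- `R_λ g = ∫_0^∞ e^{-λ t} T(t) g dt` for all `λ > 0` and `g ∈ E`. -/
def IsLaplaceTransform (R : ℝ → C(X, ℝ) →L[ℝ] C(X, ℝ)) {E : Submodule ℝ C(X, ℝ)}
    (T : ℝ≥0 → E →L[ℝ] E) : Prop :=
  ∀ lam, 0 < lam → ∀ g : E,
    R lam g = ∫ t in Ioi (0 : ℝ), Real.exp (-lam * t) • (T t.toNNReal g : C(X, ℝ))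

end Semigroups

end

/-! Nonnegativity forces `α = 0` and `β = 0`. Since `λ R⁰_λ 1 = 1 - ℓ_λ`, the formula becomes a
rank-one perturbation: `R_λ g = R⁰_λ g + (m(R⁰_λ g) / D_λ) ℓ_λ` with `D_λ = γ + m(1) - m(ℓ_λ)`. Here
`D_λ > 0`, because `ℓ_λ < 1` off the center and `m` does not charge the center. The Hilbert equation
for `R_λ` is algebra from the one for `R⁰_λ` and from `(λ - ν) R⁰_ν ℓ_λ = ℓ_ν - ℓ_λ`; the half-line
facts behind these come from uniqueness of bounded solutions of `u'' = 2λu - 2e`, `u(0) = 0`.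

At the center `R⁰_λ g` is `0` and `ℓ_λ` is `1`, so integrating the formula gives `m(R_λ g) = (γ +
m(1)) (R_λ g)(0)`, that is, `F(R_λ g) = 0`. The ranges thus lie in a proper closed subspace, which
excludes the Feller property. On that subspace there is strong continuity: split `g = h + g(0)·1`
with `h(0) = 0`; then `λ R⁰_λ h → h` uniformly, and the coefficient of `ℓ_λ` left over tends to zero
exactly because `F(g) = 0` (`tendsto_smul_resolventFormula`).

A Hille–Yosida theorem for contraction resolvents on the subspace (`exists_semigroup_submodule`)
then yields the semigroup and its uniqueness. It also shows that every closed convex set invariant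
under all `λ R_λ` is invariant under `T(t)`. The cone of nonnegative functions gives positivity; the
singleton `{1}` gives conservativity when `γ = 0`, while `1 ∈ C_F(S)` already forces `γ = 0`. -/

theorem integral_Ioi_comp_add_right {F : Type*} [NormedAddCommGroup F] [NormedSpace ℝ F]
    (f : ℝ → F) (s : ℝ) : ∫ t in Ioi (0 : ℝ), f (t + s) = ∫ t in Ioi s, f t := by
  rw [← integral_indicator measurableSet_Ioi, ← integral_indicator measurableSet_Ioi,
    ← integral_add_right_eq_self (μ := volume) ((Ioi s).indicator f) s]
  congr 1
  ext t
  simp [indicator]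

/-! ### Hille–Yosida generation and uniqueness through Yosida approximations -/

section HilleYosida

variable {E : Type*} [NormedAddCommGroup E] [NormedSpace ℝ E]

theorem integrableOn_exp_smul {T : ℝ≥0 → E →L[ℝ] E} (hcont : ∀ x, Continuous fun t => T t x)
    (hle : ∀ t x, ‖T t x‖ ≤ ‖x‖) {nu : ℝ} (hn : 0 < nu) (y : E) :
    IntegrableOn (fun t : ℝ => Real.exp (-nu * t) • T t.toNNReal y) (Ioi 0) := by
  refine ((integrableOn_exp_mul_Ioi (neg_neg_iff_pos.2 hn) 0).mul_const ‖y‖).mono'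
    ((by fun_prop : Continuous fun t : ℝ => Real.exp (-nu * t)).smul
      ((hcont y).comp continuous_real_toNNReal)).aestronglyMeasurable (ae_of_all _ fun t => ?_)
  rw [norm_smul, Real.norm_of_nonneg (Real.exp_pos _).le]
  gcongr
  exact hle _ _

/-- A contraction resolvent on a normed space: bounded operators `R_λ`, `λ > 0`, that satisfy the
Hilbert equation and `‖λ R_λ‖ ≤ 1`, with `λ R_λ → 1` strongly as `λ → ∞`. -/
structure IsContractionResolvent (R : ℝ → E →L[ℝ] E) : Prop where
  hilbert : ∀ lam nu, 0 < lam → 0 < nu → (lam - nu) • (R nu ∘L R lam) = R nu - R lam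
  contraction : ∀ lam, 0 < lam → ∀ x, ‖lam • R lam x‖ ≤ ‖x‖
  tendsto : ∀ x, Tendsto (fun lam : ℝ => lam • R lam x) atTop (𝓝 x)

/-- The Yosida approximation `λ (λ R_λ - 1)` at `λ = n + 1`. -/
noncomputable def yosida (R : ℝ → E →L[ℝ] E) (n : ℕ) : E →L[ℝ] E :=
  ((n : ℝ) + 1) • (((n : ℝ) + 1) • R (n + 1) - 1)

/-- `e^{s(B-1)} x = e^{-s} ∑ (s^n / n!) B^n x` is a Poisson average of points of `K`. Dividing each
partial sum by the matching partial sum of `e^s`, not by `e^s` itself, gives true convex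
combinations, whose limit stays in the closed set `K`. -/
theorem exp_smul_sub_one_apply_mem [CompleteSpace E] {K : Set E} (hK : Convex ℝ K)
    (hKc : IsClosed K)
    {B : E →L[ℝ] E} (hB : ∀ x ∈ K, B x ∈ K) {s : ℝ} (hs : 0 ≤ s) {x : E} (hx : x ∈ K) :
    NormedSpace.exp (s • (B - 1)) x ∈ K := by
  have h1 : NormedSpace.exp (s • (B - 1)) = Real.exp (-s) • NormedSpace.exp (s • B) := by
    have h2 : s • (B - 1) = (-s) • (1 : E →L[ℝ] E) + s • B := by
      rw [smul_sub, neg_smul]; abel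
    have h3 : NormedSpace.exp ((-s) • (1 : E →L[ℝ] E)) = Real.exp (-s) • (1 : E →L[ℝ] E) := by
      have := NormedSpace.algebraMap_exp_comm (𝕂 := ℝ) (𝔸 := E →L[ℝ] E) (-s)
      rw [Algebra.algebraMap_eq_smul_one, Algebra.algebraMap_eq_smul_one] at this
      rw [← this, Real.exp_eq_exp_ℝ]
    have hcomm : Commute ((-s) • (1 : E →L[ℝ] E)) (s • B) :=
      ((Commute.one_left B).smul_left _).smul_right _
    have hrad : ∀ z : E →L[ℝ] E, z ∈ Metric.eball (0 : E →L[ℝ] E)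
        (NormedSpace.expSeries ℝ (E →L[ℝ] E)).radius := fun z => by
      rw [NormedSpace.expSeries_radius_eq_top]; simp
    rw [h2, NormedSpace.exp_add_of_commute_of_mem_ball hcomm (hrad _) (hrad _), h3, smul_mul_assoc,
      one_mul]
  have hpow : ∀ n : ℕ, (B ^ n) x ∈ K := by
    intro n
    induction n with
    | zero => simpa using hx
    | succ n ih => rw [pow_succ']; exact hB _ ih
  have h2 : HasSum (fun n : ℕ => (s ^ n / n.factorial) • (B ^ n) x) (NormedSpace.exp (s • B) x) := by
    have h3 := NormedSpace.exp_series_hasSum_exp' (𝕂 := ℝ) (s • B)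
    have h4 := h3.mapL (ContinuousLinearMap.apply ℝ E x)
    refine h4.congr_fun ?_
    intro n
    simp only [ContinuousLinearMap.apply_apply, smul_apply, smul_pow, smul_smul]
    congr 1
    ring
  have h3 : HasSum (fun n : ℕ => s ^ n / n.factorial) (Real.exp s) := by
    rw [Real.exp_eq_exp_ℝ]; exact NormedSpace.expSeries_div_hasSum_exp s
  have h4 := (h3.tendsto_sum_nat.inv₀ (Real.exp_pos s).ne').smul h2.tendsto_sum_nat
  rw [h1, smul_apply, Real.exp_neg]
  refine hKc.mem_of_tendsto h4 ?_
  filter_upwards [eventually_ge_atTop 1] with N hN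
  refine hK.centerMass_mem (t := Finset.range N) (w := fun n : ℕ => s ^ n / n.factorial)
    (z := fun n => (B ^ n) x) (fun i _ => by positivity) ?_ (fun i _ => hpow i)
  exact Finset.sum_pos' (fun i _ => by positivity) ⟨0, Finset.mem_range.2 (by omega), by simp⟩

/-- Duhamel's argument: `s ↦ e^{(t-s)B} v(s)` has derivative `e^{(t-s)B}(v' - Bv)`, and the
exponentials are contractions. It serves both to compare two Yosida semigroups and to compare an
unknown semigroup with them. -/
theorem norm_sub_exp_smul_apply_le [CompleteSpace E] {B : E →L[ℝ] E}
    (hB : ∀ s : ℝ, 0 ≤ s → ∀ x, ‖NormedSpace.exp (s • B) x‖ ≤ ‖x‖) {v v' : ℝ → E} {t C : ℝ}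
    (ht : 0 ≤ t) (hv : ∀ s ∈ Icc 0 t, HasDerivWithinAt v (v' s) (Icc 0 t) s)
    (hC : ∀ s ∈ Ico 0 t, ‖v' s - B (v s)‖ ≤ C) :
    ‖v t - NormedSpace.exp (t • B) (v 0)‖ ≤ C * t := by
  have h1 : ∀ s ∈ Icc 0 t, HasDerivWithinAt (fun s => NormedSpace.exp ((t - s) • B) (v s))
      (NormedSpace.exp ((t - s) • B) (v' s - B (v s))) (Icc 0 t) s := by
    intro s hs
    have h2 : HasDerivAt (fun s : ℝ => NormedSpace.exp ((t - s) • B))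
        ((-1 : ℝ) • (NormedSpace.exp ((t - s) • B) * B)) s :=
      (hasDerivAt_exp_smul_const (𝕂 := ℝ) B (t - s)).scomp s ((hasDerivAt_id s).const_sub t)
    refine (h2.hasDerivWithinAt.clm_apply (hv s hs)).congr_deriv ?_
    simp only [map_sub, neg_smul, one_smul, neg_apply,
      mul_apply_eq_comp]
    abel
  have h2 := norm_image_sub_le_of_norm_deriv_le_segment' h1 (C := C)
    (fun s hs => (hB _ (by linarith [hs.2]) _).trans (hC s hs)) t (right_mem_Icc.2 ht)
  simpa using h2

namespace IsContractionResolvent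

variable {R : ℝ → E →L[ℝ] E}

theorem commute (hR : IsContractionResolvent R) {lam nu : ℝ} (hl : 0 < lam) (hn : 0 < nu) :
    Commute (R lam) (R nu) := by
  rcases eq_or_ne lam nu with rfl | hne
  · exact Commute.refl _
  · have h1 := hR.hilbert lam nu hl hn
    have h2 := hR.hilbert nu lam hn hl
    have h3 : (lam - nu) • (R nu ∘L R lam) = (lam - nu) • (R lam ∘L R nu) := by
      rw [h1, ← neg_sub nu lam, neg_smul, h2, neg_sub]
    exact (smul_right_injective _ (sub_ne_zero.2 hne) h3).symm

theorem commute_yosida (hR : IsContractionResolvent R) (n : ℕ) {nu : ℝ} (hn : 0 < nu) :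
    Commute (yosida R n) (R nu) :=
  (((hR.commute (by positivity) hn).smul_left _).sub_left (Commute.one_left _)).smul_left _

theorem commute_yosida_yosida (hR : IsContractionResolvent R) (n m : ℕ) :
    Commute (yosida R n) (yosida R m) :=
  (((hR.commute_yosida n (by positivity)).smul_right _).sub_right (Commute.one_right _)).smul_right _

/-- The Hilbert equation rewrites the Yosida approximation on the range of `R_ν` as `λ R_λ` applied
to the fixed vector `ν R_ν y - y`, the value of the generator at `R_ν y`. Convergence as `λ → ∞` is
then the strong continuity hypothesis. -/
theorem yosida_resolvent (hR : IsContractionResolvent R) (n : ℕ) {nu : ℝ} (hn : 0 < nu) (y : E) :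
    yosida R n (R nu y) = ((n : ℝ) + 1) • R (n + 1) (nu • R nu y - y) := by
  have h := DFunLike.congr_fun (hR.hilbert nu (n + 1) hn (by positivity)) y
  simp only [smul_apply, ContinuousLinearMap.comp_apply, sub_smul,
    sub_apply] at h
  simp only [yosida, smul_apply, sub_apply,
    one_apply_eq_self, map_sub, map_smul]
  congr 1
  rw [sub_eq_sub_iff_add_eq_add] at h ⊢
  rw [add_comm, ← h, add_comm]

theorem tendsto_nat (hR : IsContractionResolvent R) (x : E) :
    Tendsto (fun n : ℕ => ((n : ℝ) + 1) • R (n + 1) x) atTop (𝓝 x) :=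
  (hR.tendsto x).comp (tendsto_natCast_atTop_atTop.atTop_add tendsto_const_nhds)

theorem tendsto_yosida (hR : IsContractionResolvent R) {nu : ℝ} (hn : 0 < nu) (y : E) :
    Tendsto (fun n => yosida R n (R nu y)) atTop (𝓝 (nu • R nu y - y)) := by
  simp only [hR.yosida_resolvent _ hn]
  exact hR.tendsto_nat _

theorem exp_yosida_mem [CompleteSpace E] {K : Set E} (hK : Convex ℝ K) (hKc : IsClosed K)
    (hRK : ∀ lam, 0 < lam → ∀ x ∈ K, lam • R lam x ∈ K) {t : ℝ} (ht : 0 ≤ t) (n : ℕ) {x : E}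
    (hx : x ∈ K) : NormedSpace.exp (t • yosida R n) x ∈ K := by
  rw [yosida, smul_smul]
  exact exp_smul_sub_one_apply_mem hK hKc
    (fun x hx => hRK ((n : ℝ) + 1) (by positivity) x hx) (by positivity) hx

theorem norm_exp_yosida_le [CompleteSpace E] (hR : IsContractionResolvent R) (n : ℕ) {t : ℝ}
    (ht : 0 ≤ t) (x : E) :
    ‖NormedSpace.exp (t • yosida R n) x‖ ≤ ‖x‖ := by
  have := exp_yosida_mem (R := R) (K := Metric.closedBall 0 ‖x‖) (convex_closedBall _ _)
    Metric.isClosed_closedBall (fun lam hl y hy => by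
      rw [mem_closedBall_zero_iff] at hy ⊢
      exact (hR.contraction lam hl y).trans hy) ht n (x := x) (by simp)
  simpa using this

/-- `T` is the strong limit of the semigroups generated by the Yosida approximations. -/
def IsYosidaLimit (R : ℝ → E →L[ℝ] E) (T : ℝ≥0 → E →L[ℝ] E) : Prop :=
  ∀ (t : ℝ≥0) x, Tendsto (fun n => NormedSpace.exp ((t : ℝ) • yosida R n) x) atTop (𝓝 (T t x))

/-- Vectors in the ranges of the `R_λ` are dense. -/
theorem exists_resolvent_near (hR : IsContractionResolvent R) (x : E) {ε : ℝ} (hε : 0 < ε) :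
    ∃ nu, 0 < nu ∧ ∃ y, ‖x - R nu y‖ < ε := by
  obtain ⟨nu, h1, h2⟩ := ((Metric.tendsto_nhds.1 (hR.tendsto x) ε hε).and
    (eventually_gt_atTop 0)).exists
  refine ⟨nu, h2, nu • x, ?_⟩
  rwa [map_smul, norm_sub_rev, ← dist_eq_norm]

theorem hasDerivAt_exp_apply [CompleteSpace E] (A : E →L[ℝ] E) (x : E) (s : ℝ) :
    HasDerivAt (fun s : ℝ => NormedSpace.exp (s • A) x) (NormedSpace.exp (s • A) (A x)) s := by
  have h := (hasDerivAt_exp_smul_const (𝕂 := ℝ) A s).clm_apply (hasDerivAt_const s x)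
  simpa using h

theorem norm_exp_yosida_sub_le [CompleteSpace E] (hR : IsContractionResolvent R)
    (n m : ℕ) {t : ℝ} (ht : 0 ≤ t)
    (x : E) : ‖NormedSpace.exp (t • yosida R m) x - NormedSpace.exp (t • yosida R n) x‖ ≤
      ‖yosida R m x - yosida R n x‖ * t := by
  have h := norm_sub_exp_smul_apply_le (B := yosida R n)
    (v := fun s => NormedSpace.exp (s • yosida R m) x)
    (fun s hs x => hR.norm_exp_yosida_le n hs x) ht
    (fun s _ => (hasDerivAt_exp_apply (yosida R m) x s).hasDerivWithinAt)
    (C := ‖yosida R m x - yosida R n x‖) (fun s hs => ?_)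
  · simpa using h
  -- Commutation lets the difference of the two approximations act on `x` first, so the bound does
  -- not depend on `s`.
  · have hc : Commute (yosida R n) (NormedSpace.exp (s • yosida R m)) :=
      ((hR.commute_yosida_yosida n m).smul_right s).exp_right
    have h2 := DFunLike.congr_fun hc.eq x
    simp only [mul_apply_eq_comp] at h2
    rw [h2, ← map_sub]
    exact hR.norm_exp_yosida_le m hs.1 _

theorem exists_isYosidaLimit [CompleteSpace E] (hR : IsContractionResolvent R) :
    ∃ T : ℝ≥0 → E →L[ℝ] E, IsYosidaLimit R T := by
  have key : ∀ (t : ℝ≥0) (x : E),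
      ∃ z, Tendsto (fun n => NormedSpace.exp ((t : ℝ) • yosida R n) x) atTop (𝓝 z) := by
    intro t x
    refine cauchySeq_tendsto_of_complete (Metric.cauchySeq_iff'.2 fun ε hε => ?_)
    obtain ⟨nu, hn, y, hy⟩ := hR.exists_resolvent_near x (show 0 < ε / 4 by positivity)
    have hc : CauchySeq fun n => yosida R n (R nu y) := (hR.tendsto_yosida hn y).cauchySeq
    -- The factor `t + 1`, rather than `t`, keeps the tolerance meaningful at `t = 0`.
    obtain ⟨N, hN⟩ := Metric.cauchySeq_iff'.1 hc (ε / (4 * (t + 1))) (by positivity)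
    refine ⟨N, fun n hnN => ?_⟩
    have h1 := hR.norm_exp_yosida_sub_le N n t.2 (R nu y)
    have h2 := hN n hnN
    rw [dist_eq_norm] at h2 ⊢
    have h3 := hR.norm_exp_yosida_le n t.2 (x - R nu y)
    have h4 := hR.norm_exp_yosida_le N t.2 (x - R nu y)
    have h5 : ‖yosida R n (R nu y) - yosida R N (R nu y)‖ * t ≤ ε / 4 := by
      have ht : (0 : ℝ) ≤ t := t.2
      calc _ ≤ ε / (4 * (t + 1)) * t := by gcongr
        _ ≤ ε / (4 * (t + 1)) * (t + 1) := by gcongr; linarith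
        _ = ε / 4 := by field_simp
    have h6 : NormedSpace.exp ((t : ℝ) • yosida R n) x - NormedSpace.exp ((t : ℝ) • yosida R N) x =
        NormedSpace.exp ((t : ℝ) • yosida R n) (x - R nu y)
        + (NormedSpace.exp ((t : ℝ) • yosida R n) (R nu y)
          - NormedSpace.exp ((t : ℝ) • yosida R N) (R nu y))
        - NormedSpace.exp ((t : ℝ) • yosida R N) (x - R nu y) := by
      simp only [map_sub]; abel
    rw [h6]
    refine (norm_sub_le _ _).trans_lt ?_
    have h7 := norm_add_le (NormedSpace.exp ((t : ℝ) • yosida R n) (x - R nu y))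
      (NormedSpace.exp ((t : ℝ) • yosida R n) (R nu y)
          - NormedSpace.exp ((t : ℝ) • yosida R N) (R nu y))
    simp only [NNReal.val_eq_coe] at h1 h3 h4
    linarith
  choose T hT using key
  refine ⟨fun t => LinearMap.mkContinuous
    { toFun := T t
      map_add' := fun x y => tendsto_nhds_unique (hT t (x + y)) (by
        simpa only [map_add] using (hT t x).add (hT t y))
      map_smul' := fun c x => tendsto_nhds_unique (hT t (c • x)) (by
        simpa only [map_smul, RingHom.id_apply] using (hT t x).const_smul c) } 1 (fun x => ?_), hT⟩
  rw [one_mul]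
  exact le_of_tendsto (hT t x).norm (Eventually.of_forall fun n => hR.norm_exp_yosida_le n t.2 x)

namespace IsYosidaLimit

variable {T : ℝ≥0 → E →L[ℝ] E}

theorem apply_mem [CompleteSpace E] (hT : IsYosidaLimit R T) {K : Set E} (hK : Convex ℝ K)
    (hKc : IsClosed K)
    (hRK : ∀ lam, 0 < lam → ∀ x ∈ K, lam • R lam x ∈ K) (t : ℝ≥0) {x : E} (hx : x ∈ K) :
    T t x ∈ K :=
  hKc.mem_of_tendsto (hT t x) (Eventually.of_forall fun n => exp_yosida_mem hK hKc hRK t.2 n hx)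

theorem norm_le [CompleteSpace E] (hT : IsYosidaLimit R T) (hR : IsContractionResolvent R)
    (t : ℝ≥0) (x : E) :
    ‖T t x‖ ≤ ‖x‖ :=
  le_of_tendsto (hT t x).norm (Eventually.of_forall fun n => hR.norm_exp_yosida_le n t.2 x)

theorem zero (hT : IsYosidaLimit R T) : T 0 = ContinuousLinearMap.id ℝ E := by
  ext x
  refine tendsto_nhds_unique (hT 0 x) ?_
  simp

theorem add [CompleteSpace E] (hT : IsYosidaLimit R T) (hR : IsContractionResolvent R) (s t : ℝ≥0) :
    T (s + t) = T s ∘L T t := by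
  ext x
  refine tendsto_nhds_unique (hT (s + t) x) ?_
  have h1 : ∀ n, NormedSpace.exp (((s + t : ℝ≥0) : ℝ) • yosida R n) x =
      NormedSpace.exp ((s : ℝ) • yosida R n) (T t x) + NormedSpace.exp ((s : ℝ) • yosida R n)
        (NormedSpace.exp ((t : ℝ) • yosida R n) x - T t x) := by
    intro n
    have hrad : ∀ z : E →L[ℝ] E, z ∈ Metric.eball (0 : E →L[ℝ] E)
        (NormedSpace.expSeries ℝ (E →L[ℝ] E)).radius := fun z => by
      rw [NormedSpace.expSeries_radius_eq_top]; simp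
    rw [NNReal.coe_add, add_smul, NormedSpace.exp_add_of_commute_of_mem_ball
      (((Commute.refl _).smul_left _).smul_right _) (hrad _) (hrad _), ← map_add]
    simp
  simp only [h1]
  have h2 : Tendsto (fun n => NormedSpace.exp ((s : ℝ) • yosida R n)
        (NormedSpace.exp ((t : ℝ) • yosida R n) x - T t x)) atTop (𝓝 0) := by
    refine squeeze_zero_norm (fun n => hR.norm_exp_yosida_le n s.2 _) ?_
    have := (hT t x).sub_const (T t x)
    rw [sub_self] at this
    simpa using this.norm
  simpa using (hT s (T t x)).add h2

theorem continuous [CompleteSpace E] (hT : IsYosidaLimit R T) (hR : IsContractionResolvent R)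
    (x : E) :
    Continuous fun t => T t x := by
  have h1 : ∀ nu, 0 < nu → ∀ y, Continuous fun t => T t (R nu y) := by
    intro nu hn y
    -- On the range of `R_ν` the approximating orbits have bounded speed, and the speed bounds
    -- converge to `‖ν R_ν y - y‖`. Density then transfers continuity to every vector, uniformly in
    -- `t`.
    have h2 : ∀ s t : ℝ≥0, s ≤ t → ‖T t (R nu y) - T s (R nu y)‖ ≤
        ‖nu • R nu y - y‖ * (t - s) := by
      intro s t hst
      refine le_of_tendsto_of_tendsto ((hT t (R nu y)).sub (hT s (R nu y))).norm
        ((hR.tendsto_yosida hn y).norm.mul_const ((t : ℝ) - s)) (Eventually.of_forall fun n => ?_)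
      exact norm_image_sub_le_of_norm_deriv_le_segment'
        (fun r _ => (hasDerivAt_exp_apply (yosida R n) (R nu y) r).hasDerivWithinAt)
        (fun r hr => hR.norm_exp_yosida_le n (s.2.trans hr.1) _) t
        (right_mem_Icc.2 (by exact_mod_cast hst))
    have h3 : LipschitzWith ‖nu • R nu y - y‖₊ fun t => T t (R nu y) := by
      refine LipschitzWith.of_dist_le_mul fun s t => ?_
      rw [coe_nnnorm, NNReal.dist_eq, dist_eq_norm]
      rcases le_total s t with h | h
      · rw [norm_sub_rev, abs_sub_comm, abs_of_nonneg (sub_nonneg.2 (by exact_mod_cast h))]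
        exact h2 s t h
      · rw [abs_of_nonneg (sub_nonneg.2 (by exact_mod_cast h))]
        exact h2 t s h
    exact h3.continuous
  refine continuous_of_uniform_approx_of_continuous fun u hu => ?_
  obtain ⟨ε, hε, hεu⟩ := Metric.mem_uniformity_dist.1 hu
  obtain ⟨nu, hn, y, hy⟩ := hR.exists_resolvent_near x hε
  refine ⟨_, h1 nu hn y, fun t => hεu ?_⟩
  rw [dist_eq_norm, ← map_sub]
  exact (hT.norm_le hR t _).trans_lt hy

/-- For each bounded approximation `A_n` the integrand `e^{-νt} e^{tA_n}(νx - A_n x)` is an exact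
derivative, so its integral is `x` for every `n`. With `x = R_ν y` one has `νx - A_n x → y`, and
dominated convergence concludes. -/
theorem laplace [CompleteSpace E] (hT : IsYosidaLimit R T)
    (hR : IsContractionResolvent R) {nu : ℝ} (hn : 0 < nu)
    (y : E) : R nu y = ∫ t in Ioi (0 : ℝ), Real.exp (-nu * t) • T t.toNNReal y := by
  set x := R nu y with hx
  have hexp : IntegrableOn (fun t : ℝ => Real.exp (-nu * t)) (Ioi 0) :=
    integrableOn_exp_mul_Ioi (neg_neg_iff_pos.2 hn) 0
  have hcont : ∀ n z, Continuous fun t : ℝ => NormedSpace.exp (t • yosida R n) z := fun n z =>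
    continuous_iff_continuousAt.2 fun s => (hasDerivAt_exp_apply _ z s).continuousAt
  have hmeas : ∀ n z, AEStronglyMeasurable
      (fun t : ℝ => Real.exp (-nu * t) • NormedSpace.exp (t • yosida R n) z)
      (volume.restrict (Ioi 0)) := fun n z =>
    ((by fun_prop : Continuous fun t : ℝ => Real.exp (-nu * t)).smul (hcont n z)).aestronglyMeasurable
  have hbound : ∀ n z, ∀ t ∈ Ioi (0 : ℝ),
      ‖Real.exp (-nu * t) • NormedSpace.exp (t • yosida R n) z‖ ≤ Real.exp (-nu * t) * ‖z‖ := by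
    intro n z t ht
    rw [norm_smul, Real.norm_of_nonneg (Real.exp_pos _).le]
    gcongr
    exact hR.norm_exp_yosida_le n (le_of_lt ht) z
  have h1 : ∀ n, ∫ t in Ioi (0 : ℝ), Real.exp (-nu * t) •
      NormedSpace.exp (t • yosida R n) (nu • x - yosida R n x) = x := by
    intro n
    have hd : ∀ t ∈ Ici (0 : ℝ), HasDerivAt
        (fun t : ℝ => -(Real.exp (-nu * t) • NormedSpace.exp (t • yosida R n) x))
        (Real.exp (-nu * t) • NormedSpace.exp (t • yosida R n) (nu • x - yosida R n x)) t := by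
      intro t _
      have he : HasDerivAt (fun t : ℝ => Real.exp (-nu * t)) (Real.exp (-nu * t) * (-nu)) t := by
        simpa using ((hasDerivAt_id t).const_mul (-nu)).exp
      refine (he.smul (hasDerivAt_exp_apply (yosida R n) x t)).neg.congr_deriv ?_
      rw [map_sub, map_smul, smul_sub, smul_smul, mul_neg, neg_smul]
      abel
    have hlim : Tendsto (fun t : ℝ => -(Real.exp (-nu * t) • NormedSpace.exp (t • yosida R n) x))
        atTop (𝓝 0) := by
      have h0 : Tendsto (fun t : ℝ => Real.exp (-nu * t) * ‖x‖) atTop (𝓝 0) := by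
        have := (Real.tendsto_exp_atBot.comp
          (tendsto_id.const_mul_atTop_of_neg (neg_neg_iff_pos.2 hn))).mul_const ‖x‖
        simpa using this
      refine squeeze_zero_norm' ?_ h0
      filter_upwards [eventually_gt_atTop 0] with t ht
      rw [norm_neg]
      exact hbound n x t ht
    rw [integral_Ioi_of_hasDerivAt_of_tendsto' hd ?_ hlim]
    · simp
    · exact (hexp.mul_const ‖nu • x - yosida R n x‖).mono' (hmeas n _)
        ((ae_restrict_mem measurableSet_Ioi).mono (hbound n _))
  have hy : Tendsto (fun n => nu • x - yosida R n x) atTop (𝓝 y) := by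
    have := (hR.tendsto_yosida hn y).const_sub (nu • x)
    simpa [hx] using this
  obtain ⟨C, hC⟩ := hy.norm.isBoundedUnder_le.eventually_le
  have h2 := tendsto_integral_filter_of_dominated_convergence (μ := volume.restrict (Ioi (0 : ℝ)))
    (F := fun n t => Real.exp (-nu * t) •
      NormedSpace.exp (t • yosida R n) (nu • x - yosida R n x))
    (f := fun t => Real.exp (-nu * t) • T t.toNNReal y) (l := atTop)
    (fun t => Real.exp (-nu * t) * C) (Eventually.of_forall fun n => hmeas n _) ?_
    (hexp.mul_const C) ?_
  · simp only [h1] at h2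
    exact tendsto_nhds_unique tendsto_const_nhds h2
  · filter_upwards [hC] with n hnC
    filter_upwards [ae_restrict_mem measurableSet_Ioi] with t ht
    refine (hbound n _ t ht).trans ?_
    gcongr
  · filter_upwards [ae_restrict_mem measurableSet_Ioi] with t ht
    have ht : (0 : ℝ) < t := ht
    refine Tendsto.const_smul ?_ _
    have h3 := hT t.toNNReal y
    rw [Real.coe_toNNReal t ht.le] at h3
    have h4 : Tendsto (fun n => NormedSpace.exp (t • yosida R n) ((nu • x - yosida R n x) - y))
        atTop (𝓝 0) := by
      refine squeeze_zero_norm (fun n => hR.norm_exp_yosida_le n ht.le _) ?_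
      have := hy.sub_const y
      rw [sub_self] at this
      simpa using this.norm
    have h5 := h4.add h3
    simpa only [← map_add, sub_add_cancel, zero_add] using h5

end IsYosidaLimit

/-- A strongly continuous contraction semigroup is determined by its Laplace transform. -/
theorem isYosidaLimit_of_laplace [CompleteSpace E]
    (hR : IsContractionResolvent R) {T : ℝ≥0 → E →L[ℝ] E}
    (hT0 : T 0 = ContinuousLinearMap.id ℝ E) (hadd : ∀ s t, T (s + t) = T s ∘L T t)
    (hcont : ∀ x, Continuous fun t => T t x) (hle : ∀ t x, ‖T t x‖ ≤ ‖x‖)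
    (hL : ∀ nu, 0 < nu → ∀ y,
      R nu y = ∫ t in Ioi (0 : ℝ), Real.exp (-nu * t) • T t.toNNReal y) :
    IsYosidaLimit R T := by
  have hcont' : ∀ nu y, Continuous fun t : ℝ => Real.exp (-nu * t) • T t.toNNReal y := fun nu y =>
    (by fun_prop : Continuous fun t : ℝ => Real.exp (-nu * t)).smul
      ((hcont y).comp continuous_real_toNNReal)
  have hint : ∀ nu, 0 < nu → ∀ y,
      IntegrableOn (fun t : ℝ => Real.exp (-nu * t) • T t.toNNReal y) (Ioi 0) := fun nu hn y =>
    integrableOn_exp_smul hcont hle hn y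
  have hcomm : ∀ nu, 0 < nu → ∀ s y, R nu (T s y) = T s (R nu y) := by
    intro nu hn s y
    rw [hL nu hn, hL nu hn, ← ContinuousLinearMap.integral_comp_comm _ (hint nu hn y)]
    refine integral_congr_ae (ae_of_all _ fun t => ?_)
    simp only [map_smul]
    congr 1
    rw [← ContinuousLinearMap.comp_apply, ← ContinuousLinearMap.comp_apply, ← hadd, ← hadd,
      add_comm]
  -- Shifting time by `s` in the Laplace integral leaves its tail beyond `s`. Writing the tail as
  -- the total minus an integral over `[0, s]` exposes the orbit of `R_ν y` to the fundamental
  -- theorem of calculus.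
  have hshift : ∀ nu, 0 < nu → ∀ s : ℝ, 0 ≤ s → ∀ y, T s.toNNReal (R nu y) =
      Real.exp (nu * s) • (R nu y - ∫ r in (0 : ℝ)..s, Real.exp (-nu * r) • T r.toNNReal y) := by
    intro nu hn s hs y
    have h1 : R nu y - (∫ r in (0 : ℝ)..s, Real.exp (-nu * r) • T r.toNNReal y) =
        ∫ t in Ioi s, Real.exp (-nu * t) • T t.toNNReal y := by
      rw [hL nu hn y, ← intervalIntegral.integral_interval_add_Ioi (hint nu hn y)
        ((hint nu hn y).mono_set (Ioi_subset_Ioi hs)), add_sub_cancel_left]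
    rw [h1, hL nu hn y, ← ContinuousLinearMap.integral_comp_comm _ (hint nu hn y),
      ← integral_smul]
    have h2 := integral_Ioi_comp_add_right
      (fun t => Real.exp (nu * s) • Real.exp (-nu * t) • T t.toNNReal y) s
    rw [← h2]
    refine setIntegral_congr_fun measurableSet_Ioi fun t ht => ?_
    have ht : (0 : ℝ) < t := ht
    simp only [map_smul]
    rw [smul_smul, ← Real.exp_add, ← ContinuousLinearMap.comp_apply, ← hadd,
      ← Real.toNNReal_add hs ht.le, add_comm s t]
    congr 2
    ring
  have hderiv : ∀ nu, 0 < nu → ∀ y (t : ℝ), ∀ s ∈ Icc 0 t,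
      HasDerivWithinAt (fun s : ℝ => T s.toNNReal (R nu y))
        (T s.toNNReal (nu • R nu y - y)) (Icc 0 t) s := by
    intro nu hn y t s hs
    have hI : HasDerivAt (fun s : ℝ => ∫ r in (0 : ℝ)..s, Real.exp (-nu * r) • T r.toNNReal y)
        (Real.exp (-nu * s) • T s.toNNReal y) s :=
      intervalIntegral.integral_hasDerivAt_right ((hcont' nu y).intervalIntegrable _ _)
        (hcont' nu y).aestronglyMeasurable.stronglyMeasurableAtFilter (hcont' nu y).continuousAt
    have he : HasDerivAt (fun s : ℝ => Real.exp (nu * s)) (Real.exp (nu * s) * nu) s := by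
      simpa using ((hasDerivAt_id s).const_mul nu).exp
    have hd := (he.smul (hI.const_sub (R nu y))).hasDerivWithinAt (s := Icc 0 t)
    refine (hd.congr (fun r hr => hshift nu hn r hr.1 y) (hshift nu hn s hs.1 y)).congr_deriv ?_
    rw [map_sub, map_smul, hshift nu hn s hs.1, smul_neg, smul_smul, ← Real.exp_add, mul_comm _ nu,
      mul_smul]
    have : nu * s + -nu * s = 0 := by ring
    rw [this, Real.exp_zero, one_smul]
    abel
  have hyos : ∀ n s y, yosida R n (T s y) = T s (yosida R n y) := by
    intro n s y
    simp only [yosida, smul_apply, sub_apply,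
      one_apply_eq_self, map_sub, map_smul, hcomm _ (by positivity : (0 : ℝ) < n + 1)]
  -- Duhamel's bound with `v(s) = T(s) R_ν y`; since `T(s)` commutes with the Yosida approximation,
  -- the defect is `T(s)` of a fixed vector that tends to zero with `n`.
  have hdiff : ∀ nu, 0 < nu → ∀ y (t : ℝ≥0) n,
      ‖T t (R nu y) - NormedSpace.exp ((t : ℝ) • yosida R n) (R nu y)‖ ≤
        ‖(nu • R nu y - y) - yosida R n (R nu y)‖ * t := by
    intro nu hn y t n
    have h := norm_sub_exp_smul_apply_le (B := yosida R n)
      (fun s hs x => hR.norm_exp_yosida_le n hs x) t.2 (hderiv nu hn y t)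
      (C := ‖(nu • R nu y - y) - yosida R n (R nu y)‖) (fun s hs => by
        rw [hyos, ← map_sub]; exact hle _ _)
    simpa [hT0] using h
  intro t x
  rw [Metric.tendsto_nhds]
  intro ε hε
  obtain ⟨nu, hn, y, hy⟩ := hR.exists_resolvent_near x (show 0 < ε / 3 by positivity)
  have h1 : Tendsto (fun n => ‖(nu • R nu y - y) - yosida R n (R nu y)‖ * t) atTop (𝓝 0) := by
    have := (((hR.tendsto_yosida hn y).const_sub (nu • R nu y - y)).norm).mul_const (t : ℝ)
    simpa using this
  filter_upwards [h1.eventually_lt_const (show 0 < ε / 3 by positivity)] with n hnε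
  have h2 := hdiff nu hn y t n
  have h3 := hR.norm_exp_yosida_le n t.2 (x - R nu y)
  have h4 := hle t (x - R nu y)
  have h5 : T t x - NormedSpace.exp ((t : ℝ) • yosida R n) x = T t (x - R nu y) +
      (T t (R nu y) - NormedSpace.exp ((t : ℝ) • yosida R n) (R nu y)) -
      NormedSpace.exp ((t : ℝ) • yosida R n) (x - R nu y) := by
    simp only [map_sub]; abel
  rw [dist_comm, dist_eq_norm, h5]
  have h6 := norm_sub_le (T t (x - R nu y) +
      (T t (R nu y) - NormedSpace.exp ((t : ℝ) • yosida R n) (R nu y)))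
      (NormedSpace.exp ((t : ℝ) • yosida R n) (x - R nu y))
  have h7 := norm_add_le (T t (x - R nu y))
      (T t (R nu y) - NormedSpace.exp ((t : ℝ) • yosida R n) (R nu y))
  simp only [NNReal.val_eq_coe] at h3
  linarith

end IsContractionResolvent

/-- A contraction pseudo-resolvent with range in a closed subspace `E` that is strongly continuous
on `E` is the Laplace transform of exactly one contraction semigroup on `E`. -/
theorem exists_semigroup_submodule {F : Type*} [NormedAddCommGroup F] [NormedSpace ℝ F]
    [CompleteSpace F] {R : ℝ → F →L[ℝ] F} {E : Submodule ℝ F} [CompleteSpace E]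
    (hilbert : ∀ lam nu, 0 < lam → 0 < nu → (lam - nu) • (R nu ∘L R lam) = R nu - R lam)
    (contraction : ∀ lam, 0 < lam → ∀ x, ‖lam • R lam x‖ ≤ ‖x‖) (hRE : ∀ lam x, R lam x ∈ E)
    (hlim : ∀ x ∈ E, Tendsto (fun lam : ℝ => lam • R lam x) atTop (𝓝 x)) :
    ∃ T : ℝ≥0 → E →L[ℝ] E, T 0 = ContinuousLinearMap.id ℝ E ∧ (∀ s t, T (s + t) = T s ∘L T t) ∧
      (∀ x, Continuous fun t => T t x) ∧ (∀ t x, ‖T t x‖ ≤ ‖x‖) ∧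
      (∀ lam, 0 < lam → ∀ x : E,
        R lam x = ∫ t in Ioi (0 : ℝ), Real.exp (-lam * t) • (T t.toNNReal x : F)) ∧
      (∀ T' : ℝ≥0 → E →L[ℝ] E, T' 0 = ContinuousLinearMap.id ℝ E →
        (∀ s t, T' (s + t) = T' s ∘L T' t) → (∀ x, Continuous fun t => T' t x) →
        (∀ t x, ‖T' t x‖ ≤ ‖x‖) →
        (∀ lam, 0 < lam → ∀ x : E,
          R lam x = ∫ t in Ioi (0 : ℝ), Real.exp (-lam * t) • (T' t.toNNReal x : F)) → T' = T) ∧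
      ∀ K : Set F, Convex ℝ K → IsClosed K → (∀ lam, 0 < lam → ∀ x ∈ K, lam • R lam x ∈ K) →
        ∀ t (x : E), (x : F) ∈ K → (T t x : F) ∈ K := by
  let S : ℝ → E →L[ℝ] E := fun lam =>
    ((R lam) ∘L E.subtypeL).codRestrict E (fun x => hRE lam x)
  have hScoe : ∀ lam (x : E), (S lam x : F) = R lam x := fun lam x => rfl
  have hS : IsContractionResolvent S := by
    refine ⟨fun lam nu hl hn => ?_, fun lam hl x => contraction lam hl x, fun x => ?_⟩
    · ext x
      exact DFunLike.congr_fun (hilbert lam nu hl hn) (x : F)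
    · exact tendsto_subtype_rng.2 (hlim x x.2)
  -- Reconciles the Bochner integral taken in `E` with the one taken in `F`.
  have hcoe : ∀ {T : ℝ≥0 → E →L[ℝ] E}, (∀ x, Continuous fun t => T t x) →
      (∀ t x, ‖T t x‖ ≤ ‖x‖) → ∀ lam, 0 < lam → ∀ x : E,
      ((∫ t in Ioi (0 : ℝ), Real.exp (-lam * t) • T t.toNNReal x : E) : F) =
        ∫ t in Ioi (0 : ℝ), Real.exp (-lam * t) • (T t.toNNReal x : F) := fun hc hle lam hl x =>
    (E.subtypeL.integral_comp_comm (integrableOn_exp_smul hc hle hl x)).symm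
  obtain ⟨T, hT⟩ := hS.exists_isYosidaLimit
  refine ⟨T, hT.zero, hT.add hS, hT.continuous hS, hT.norm_le hS, fun lam hl x => ?_,
    fun T' h0 hadd hc hle hL => ?_, fun K hK hKc hRK t x hx => ?_⟩
  · rw [← hcoe (hT.continuous hS) (hT.norm_le hS) lam hl x, ← hT.laplace hS hl x, hScoe]
  · have h := hS.isYosidaLimit_of_laplace h0 hadd hc hle (fun nu hn y => Subtype.ext (by
      rw [hcoe hc hle nu hn y, hScoe, hL nu hn y]))
    funext t
    ext1 x
    exact tendsto_nhds_unique (h t x) (hT t x)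
  · exact hT.apply_mem (K := {x : E | (x : F) ∈ K}) (hK.linear_preimage E.subtype)
      (hKc.preimage continuous_subtype_val) (fun lam hl x hx => hRK lam hl x hx) t hx

end HilleYosida

namespace StarGraph

/-! ### The killed resolvent on the half-line as an ODE problem -/

section HalfLine

theorem constant_of_hasDerivAt_zero {f : ℝ → ℝ} (hf : ∀ x, 0 ≤ x → HasDerivAt f 0 x) {x : ℝ}
    (hx : 0 ≤ x) : f x = f 0 :=
  constant_of_has_deriv_right_zero
    (fun y hy => (hf y hy.1).continuousAt.continuousWithinAt)
    (fun y hy => (hf y hy.1).hasDerivWithinAt) x ⟨hx, le_rfl⟩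

theorem hasDerivAt_exp_mul (a x : ℝ) :
    HasDerivAt (fun x : ℝ => Real.exp (a * x)) (a * Real.exp (a * x)) x := by
  simpa [mul_comm] using ((hasDerivAt_id x).const_mul a).exp

/-- A bounded solution of `w'' = a² w` on `[0, ∞)` with `w(0) = 0` vanishes. -/
theorem eq_zero_of_hasDerivAt {a : ℝ} (ha : 0 < a) {w w' : ℝ → ℝ}
    (hw : ∀ x, 0 ≤ x → HasDerivAt w (w' x) x) (hw' : ∀ x, 0 ≤ x → HasDerivAt w' (a ^ 2 * w x) x)
    (h0 : w 0 = 0) {M : ℝ} (hM : ∀ x, 0 ≤ x → |w x| ≤ M) {x : ℝ} (hx : 0 ≤ x) : w x = 0 := by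
  -- Factor `D² - a²` as `(D - a)(D + a)`: the function `w' + aw` solves a first-order equation.
  obtain ⟨c, hc⟩ : ∃ c, ∀ x, 0 ≤ x → w' x + a * w x = c * Real.exp (a * x) := by
    refine ⟨w' 0, fun x hx => ?_⟩
    have h1 := constant_of_hasDerivAt_zero (f := fun x => (w' x + a * w x) * Real.exp (-a * x))
      (fun x hx => (((hw' x hx).add ((hw x hx).const_mul a)).mul
        (hasDerivAt_exp_mul (-a) x)).congr_deriv (by simp only [Pi.add_apply]; ring)) hx
    simp only [h0, mul_zero, add_zero, Real.exp_zero, mul_one, neg_mul, Real.exp_neg] at h1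
    rw [← h1, mul_assoc, inv_mul_cancel₀ (Real.exp_pos _).ne', mul_one]
  have h2 : ∀ x, 0 ≤ x → w x = c * (Real.exp (a * x) - Real.exp (-a * x)) / (2 * a) := by
    intro x hx
    have h1 := constant_of_hasDerivAt_zero
      (f := fun x => w x * Real.exp (a * x) - c / (2 * a) * Real.exp ((2 * a) * x))
      (fun x hx => (((hw x hx).mul (hasDerivAt_exp_mul a x)).sub
        ((hasDerivAt_exp_mul (2 * a) x).const_mul _)).congr_deriv (by
          have h3 : Real.exp (2 * a * x) = Real.exp (a * x) * Real.exp (a * x) := by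
            rw [← Real.exp_add]; ring_nf
          have h4 := hc x hx
          rw [h3]
          field_simp
          linear_combination (Real.exp (a * x)) * h4)) hx
    simp only [h0, mul_zero, Real.exp_zero, mul_one, zero_sub] at h1
    have h3 : Real.exp (2 * a * x) = Real.exp (a * x) * Real.exp (a * x) := by
      rw [← Real.exp_add]; ring_nf
    rw [h3] at h1
    rw [neg_mul, Real.exp_neg]
    have h5 := (Real.exp_pos (a * x)).ne'
    field_simp at h1 ⊢
    linear_combination h1
  have hc0 : c = 0 := by
    by_contra hc0
    have hcp : 0 < |c| := abs_pos.2 hc0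
    have hM0 : 0 ≤ M := (abs_nonneg _).trans (hM 0 le_rfl)
    -- At this point the linear lower bound `ay ≤ e^{ay} - e^{-ay}` already gives `|c|ay = a(2M +
    -- 1)`, exceeding the `2aM` that boundedness allows.
    set y : ℝ := (2 * M + 1) / |c| with hy
    have hy0 : 0 ≤ y := by positivity
    have h3 := hM y hy0
    rw [h2 y hy0, abs_div, abs_mul, abs_of_pos (by positivity : 0 < 2 * a),
      div_le_iff₀ (by positivity)] at h3
    have h4 : a * y ≤ |Real.exp (a * y) - Real.exp (-a * y)| := by
      refine le_trans ?_ (le_abs_self _)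
      have h5 := Real.add_one_le_exp (a * y)
      have h6 : Real.exp (-a * y) ≤ 1 := Real.exp_le_one_iff.2 (by nlinarith)
      linarith
    have h5 : |c| * (a * y) ≤ M * (2 * a) := (mul_le_mul_of_nonneg_left h4 hcp.le).trans h3
    have h6 : |c| * (a * y) = a * (2 * M + 1) := by rw [hy]; field_simp
    nlinarith
  rw [h2 x hx, hc0]
  simp

theorem integrableOn_exp_neg_mul {a : ℝ} (ha : 0 < a) {e : ℝ → ℝ} (he : Continuous e) {M : ℝ}
    (hM : ∀ y, |e y| ≤ M) : IntegrableOn (fun y => Real.exp (-a * y) * e y) (Ioi 0) := by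
  simpa using integrable_exp_add_mul ha he hM 0

/-- On `[0, ∞)` the function `u = R⁰_λ e` solves `u'' = 2 λ u - 2 e`. -/
theorem exists_minResHalfLine_hasDerivAt {lam : ℝ} (hl : 0 < lam) {e : ℝ → ℝ} (he : Continuous e)
    {M : ℝ} (hM : ∀ y, |e y| ≤ M) :
    ∃ u u' : ℝ → ℝ, (∀ x, 0 ≤ x → u x = minResHalfLine lam e x) ∧
      (∀ x, HasDerivAt u (u' x) x) ∧ ∀ x, HasDerivAt u' (2 * lam * u x - 2 * e x) x := by
  set a := √(2 * lam) with ha_def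
  have ha : 0 < a := by positivity
  have hsq : a * a = 2 * lam := Real.mul_self_sqrt (by positivity)
  set C := ∫ y in Ioi (0 : ℝ), Real.exp (-a * y) * e y with hC
  set P : ℝ → ℝ := fun x => ∫ y in (0 : ℝ)..x, Real.exp (a * y) * e y with hP
  set Q : ℝ → ℝ := fun x => ∫ y in (0 : ℝ)..x, Real.exp (-a * y) * e y with hQ
  have hPd : ∀ x, HasDerivAt P (Real.exp (a * x) * e x) x := fun x =>
    (by fun_prop : Continuous fun y => Real.exp (a * y) * e y).integral_hasStrictDerivAt 0 x
      |>.hasDerivAt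
  have hQd : ∀ x, HasDerivAt Q (Real.exp (-a * x) * e x) x := fun x =>
    (by fun_prop : Continuous fun y => Real.exp (-a * y) * e y).integral_hasStrictDerivAt 0 x
      |>.hasDerivAt
  -- The integral is split at `y = x`, which removes the absolute value. The resulting expression is
  -- smooth enough on all of `ℝ` to have two-sided derivatives at `0`, but represents `R⁰_λ e` only
  -- for `x ≥ 0`.
  refine ⟨fun x => 1 / a * (Real.exp (-a * x) * P x + Real.exp (a * x) * (C - Q x)
      - Real.exp (-a * x) * C),
    fun x => -(Real.exp (-a * x) * P x) + Real.exp (a * x) * (C - Q x) + Real.exp (-a * x) * C,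
    fun x hx => ?_, fun x => ?_, fun x => ?_⟩
  · have h1 : ∫ y in Ioi (0 : ℝ), Real.exp (-a * |x - y|) * e y =
        Real.exp (-a * x) * P x + Real.exp (a * x) * (C - Q x) := by
      have hi := integrable_exp_abs_mul ha he hM x
      rw [← intervalIntegral.integral_interval_add_Ioi hi (hi.mono_set (Ioi_subset_Ioi hx))]
      congr 1
      · rw [hP, ← intervalIntegral.integral_const_mul]
        refine intervalIntegral.integral_congr fun y hy => ?_
        rw [uIcc_of_le hx] at hy
        simp only [abs_of_nonneg (sub_nonneg.2 hy.2), ← mul_assoc, ← Real.exp_add]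
        ring_nf
      · have h2 : C - Q x = ∫ y in Ioi x, Real.exp (-a * y) * e y := by
          have hi' := integrableOn_exp_neg_mul ha he hM
          rw [hC, ← intervalIntegral.integral_interval_add_Ioi hi'
            (hi'.mono_set (Ioi_subset_Ioi hx)), hQ, add_sub_cancel_left]
        rw [h2, ← integral_const_mul]
        refine setIntegral_congr_fun measurableSet_Ioi fun y hy => ?_
        have hy : x < y := hy
        simp only [abs_of_neg (sub_neg.2 hy), ← mul_assoc, ← Real.exp_add]
        ring_nf
    have h2 : ∫ y in Ioi (0 : ℝ), Real.exp (-a * (x + y)) * e y = Real.exp (-a * x) * C := by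
      rw [hC, ← integral_const_mul]
      refine setIntegral_congr_fun measurableSet_Ioi fun y hy => ?_
      simp only [← mul_assoc, ← Real.exp_add]
      ring_nf
    simp only [minResHalfLine, sub_mul]
    rw [integral_sub (integrable_exp_abs_mul ha he hM x) (integrable_exp_add_mul ha he hM x),
      h1, h2]
  · have h1 := hasDerivAt_exp_mul a x
    have h2 := hasDerivAt_exp_mul (-a) x
    refine (((h2.mul (hPd x)).add (h1.mul ((hQd x).const_sub C))).sub
      (h2.mul_const C)).const_mul (1 / a) |>.congr_deriv ?_
    field_simp
    ring
  · have h1 := hasDerivAt_exp_mul a x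
    have h2 := hasDerivAt_exp_mul (-a) x
    have h3 : Real.exp (-a * x) * Real.exp (a * x) = 1 := by rw [← Real.exp_add]; simp
    refine ((h2.mul (hPd x)).neg.add (h1.mul ((hQd x).const_sub C))).add
      (h2.mul_const C) |>.congr_deriv ?_
    rw [← hsq]
    field_simp
    rw [neg_mul] at h3
    linear_combination (-2 * e x) * h3

/-- `R⁰_λ e` is the only bounded solution of `u'' = 2 λ u - 2 e` on `[0, ∞)` with `u(0) = 0`. -/
theorem minResHalfLine_eq_of_hasDerivAt {lam : ℝ} (hl : 0 < lam) {e : ℝ → ℝ} (he : Continuous e)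
    {M : ℝ} (hM : ∀ y, |e y| ≤ M) {u u' : ℝ → ℝ} (hu : ∀ x, 0 ≤ x → HasDerivAt u (u' x) x)
    (hu' : ∀ x, 0 ≤ x → HasDerivAt u' (2 * lam * u x - 2 * e x) x) (h0 : u 0 = 0) {N : ℝ}
    (hN : ∀ x, 0 ≤ x → |u x| ≤ N) {x : ℝ} (hx : 0 ≤ x) : minResHalfLine lam e x = u x := by
  obtain ⟨v, v', hv, hv1, hv2⟩ := exists_minResHalfLine_hasDerivAt hl he hM
  have hsq : √(2 * lam) ^ 2 = 2 * lam := Real.sq_sqrt (by positivity)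
  have h := eq_zero_of_hasDerivAt (a := √(2 * lam)) (by positivity)
    (w := fun x => v x - u x) (w' := fun x => v' x - u' x)
    (fun x hx => (hv1 x).sub (hu x hx))
    (fun x hx => ((hv2 x).sub (hu' x hx)).congr_deriv (by rw [hsq]; ring))
    (by simp [hv, minResHalfLine_zero, h0]) (M := 1 / lam * M + N)
    (fun x hx => (abs_sub _ _).trans (add_le_add (by
      rw [hv x hx]; exact abs_minResHalfLine_le hl hM hx) (hN x hx))) hx
  rw [← hv x hx]
  linarith

theorem minResHalfLine_one {lam : ℝ} (hl : 0 < lam) {x : ℝ} (hx : 0 ≤ x) :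
    minResHalfLine lam (fun _ => 1) x = (1 - Real.exp (-√(2 * lam) * x)) / lam := by
  have hsq : √(2 * lam) * √(2 * lam) = 2 * lam := Real.mul_self_sqrt (by positivity)
  refine minResHalfLine_eq_of_hasDerivAt hl continuous_const (M := 1) (by simp)
    (u' := fun x => √(2 * lam) * Real.exp (-√(2 * lam) * x) / lam)
    (fun x _ => (((hasDerivAt_exp_mul _ x).const_sub 1).div_const lam).congr_deriv (by ring))
    (fun x _ => (((hasDerivAt_exp_mul _ x).const_mul (√(2 * lam))).div_const lam).congr_deriv ?_)
    (by simp) (N := 1 / lam) (fun x hx => ?_) hx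
  · field_simp
    linear_combination (-Real.exp (-(√(2 * lam) * x))) * hsq
  · have h1 : Real.exp (-√(2 * lam) * x) ≤ 1 := Real.exp_le_one_iff.2 (by
      have : 0 ≤ √(2 * lam) := Real.sqrt_nonneg _
      nlinarith)
    rw [abs_div, abs_of_pos hl, abs_of_nonneg (by linarith)]
    gcongr
    linarith [Real.exp_pos (-√(2 * lam) * x)]

/-- The difference `R⁰_ν e - R⁰_λ e` is a bounded solution of the equation that characterizes `R⁰_ν`
of `(λ - ν) R⁰_λ e`. The auxiliary `f` is needed because the formula for `R⁰_λ e` may be unbounded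
on the negative axis. -/
theorem minResHalfLine_hilbert {lam nu : ℝ} (hl : 0 < lam) (hn : 0 < nu) {e : ℝ → ℝ}
    (he : Continuous e) {M : ℝ} (hM : ∀ y, |e y| ≤ M) {f : ℝ → ℝ} (hf : Continuous f) {N : ℝ}
    (hN : ∀ y, |f y| ≤ N) (hef : ∀ x, 0 ≤ x → f x = minResHalfLine lam e x) {x : ℝ} (hx : 0 ≤ x) :
    (lam - nu) * minResHalfLine nu f x = minResHalfLine nu e x - minResHalfLine lam e x := by
  obtain ⟨u, u', hu, hu1, hu2⟩ := exists_minResHalfLine_hasDerivAt hn he hM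
  obtain ⟨v, v', hv, hv1, hv2⟩ := exists_minResHalfLine_hasDerivAt hl he hM
  have h1 : (lam - nu) * minResHalfLine nu f x = minResHalfLine nu (fun y => (lam - nu) * f y) x := by
    simp only [minResHalfLine]
    rw [mul_left_comm, ← integral_const_mul]
    simp only [mul_left_comm]
  rw [h1, ← hu x hx, ← hv x hx]
  refine minResHalfLine_eq_of_hasDerivAt hn (e := fun y => (lam - nu) * f y)
    (continuous_const.mul hf) (M := |lam - nu| * N)
    (fun y => by rw [abs_mul]; gcongr; exact hN y) (u := fun x => u x - v x)
    (u' := fun x => u' x - v' x) (fun x _ => (hu1 x).sub (hv1 x))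
    (fun x hx => ((hu2 x).sub (hv2 x)).congr_deriv ?_)
    (by simp [hu, hv, minResHalfLine_zero]) (N := 1 / nu * M + 1 / lam * M) (fun x hx => ?_) hx
  · rw [hef x hx, ← hv x hx]; ring
  · refine (abs_sub _ _).trans (add_le_add ?_ ?_)
    · rw [hu x hx]; exact abs_minResHalfLine_le hn hM hx
    · rw [hv x hx]; exact abs_minResHalfLine_le hl hM hx

theorem kernel_nonneg {a x y : ℝ} (ha : 0 < a) (hx : 0 ≤ x) (hy : 0 ≤ y) :
    0 ≤ Real.exp (-a * |x - y|) - Real.exp (-a * (x + y)) := by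
  have h1 : |x - y| ≤ x + y := abs_le.2 ⟨by linarith, by linarith⟩
  exact sub_nonneg.2 (Real.exp_le_exp.2 (by nlinarith))

theorem minResHalfLine_nonneg {lam : ℝ} (hl : 0 < lam) {e : ℝ → ℝ} (he : ∀ y, 0 ≤ e y) {x : ℝ}
    (hx : 0 ≤ x) : 0 ≤ minResHalfLine lam e x :=
  mul_nonneg (by positivity) (setIntegral_nonneg measurableSet_Ioi fun y hy =>
    mul_nonneg (kernel_nonneg (by positivity) hx (le_of_lt hy)) (he y))

theorem mul_exp_neg_mul_le {a z : ℝ} (ha : 0 < a) : z * Real.exp (-a * z) ≤ 1 / a := by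
  have h1 := Real.add_one_le_exp (a * z)
  rw [neg_mul, Real.exp_neg, ← div_eq_mul_inv, div_le_div_iff₀ (Real.exp_pos _) ha]
  linarith

/-- The kernel concentrates around `x` at scale `1 / √(2λ)`. Its missing mass `e^{-√(2λ)x}` is
harmless because `e(0) = 0` makes `e(x)` small where that mass is not. The interior error
contributes `ε + 4C/√(2λ)` and the boundary loss `ε + C/√(2λ)`. -/
theorem abs_mul_minResHalfLine_sub_le {lam : ℝ} (hl : 0 < lam) {e : ℝ → ℝ} (he : Continuous e)
    {M : ℝ} (hM : ∀ y, |e y| ≤ M) (h0 : e 0 = 0) {ε C : ℝ} (hε : 0 ≤ ε) (hC : 0 ≤ C)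
    (hmod : ∀ x y, 0 ≤ x → 0 ≤ y → |e x - e y| ≤ ε + C * |x - y|) {x : ℝ} (hx : 0 ≤ x) :
    |lam * minResHalfLine lam e x - e x| ≤ 2 * ε + 5 * C / √(2 * lam) := by
  have h1 := minResHalfLine_one hl hx
  set a := √(2 * lam) with ha_def
  have ha : 0 < a := by positivity
  have hsq : a * a = 2 * lam := Real.mul_self_sqrt (by positivity)
  set I := ∫ y in Ioi (0 : ℝ), (Real.exp (-a * |x - y|) - Real.exp (-a * (x + y))) * (e y - e x)
    with hI
  have h2 : lam * minResHalfLine lam e x - e x = lam / a * I - e x * Real.exp (-a * x) := by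
    have hi1 := integrable_kernel ha he hM x
    have hi2 := integrable_kernel ha (e := fun _ => (1 : ℝ)) continuous_const (M := 1) (by simp) x
    have h3 : I = (∫ y in Ioi (0 : ℝ), (Real.exp (-a * |x - y|) - Real.exp (-a * (x + y))) * e y)
        - e x * ∫ y in Ioi (0 : ℝ), (Real.exp (-a * |x - y|) - Real.exp (-a * (x + y))) * 1 := by
      rw [hI, ← integral_const_mul, ← integral_sub hi1 (hi2.const_mul _)]
      congr 1
      ext y
      ring
    have h4 : lam * (1 / a * ∫ y in Ioi (0 : ℝ),
        (Real.exp (-a * |x - y|) - Real.exp (-a * (x + y))) * 1) = 1 - Real.exp (-a * x) := by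
      rw [minResHalfLine, ← ha_def] at h1
      rw [h1]
      field_simp
    rw [h3, minResHalfLine, ← ha_def]
    linear_combination (e x) * h4
  have hexp : ∀ b : ℝ, 0 < b → Integrable fun y => Real.exp (-b * |x - y|) := fun b hb =>
    (integrable_exp_neg_abs hb).comp_sub_left x
  have hexpi : ∀ b : ℝ, 0 < b → ∫ y, Real.exp (-b * |x - y|) = 2 / b := fun b hb => by
    rw [integral_sub_left_eq_self (fun z => Real.exp (-b * |z|)) volume x, integral_exp_neg_abs hb]
  have h3 : |I| ≤ ε * (2 / a) + C * (2 / a) * (2 / (a / 2)) := by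
    have hint := ((hexp a ha).const_mul ε).add ((hexp (a / 2) (by positivity)).const_mul (C * (2 / a)))
    calc |I| ≤ ∫ y in Ioi (0 : ℝ), (ε * Real.exp (-a * |x - y|)
            + C * (2 / a) * Real.exp (-(a / 2) * |x - y|)) := by
          rw [← Real.norm_eq_abs]
          refine norm_integral_le_of_norm_le hint.integrableOn ?_
          filter_upwards [ae_restrict_mem measurableSet_Ioi] with y hy
          have hy : 0 < y := hy
          rw [norm_mul, Real.norm_of_nonneg (kernel_nonneg ha hx hy.le), Real.norm_eq_abs]
          -- Half of the exponential decay absorbs the factor `|x - y|`; the other half remains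
          -- integrable.
          have h5 : |x - y| * Real.exp (-a * |x - y|) ≤
              (2 / a) * Real.exp (-(a / 2) * |x - y|) := by
            have h6 := mul_exp_neg_mul_le (a := a / 2) (z := |x - y|) (by positivity)
            have h7 : Real.exp (-a * |x - y|) =
                Real.exp (-(a / 2) * |x - y|) * Real.exp (-(a / 2) * |x - y|) := by
              rw [← Real.exp_add]; ring_nf
            rw [h7, ← mul_assoc]
            refine mul_le_mul_of_nonneg_right (h6.trans_eq ?_) (Real.exp_pos _).le
            field_simp
          calc _ ≤ Real.exp (-a * |x - y|) * (ε + C * |x - y|) := by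
                refine mul_le_mul ?_ ?_ (abs_nonneg _) (Real.exp_pos _).le
                · linarith [Real.exp_pos (-a * (x + y))]
                · rw [abs_sub_comm]; exact hmod x y hx hy.le
            _ = ε * Real.exp (-a * |x - y|) + C * (|x - y| * Real.exp (-a * |x - y|)) := by ring
            _ ≤ _ := by
                rw [mul_assoc C]
                gcongr
      _ ≤ ∫ y, (ε * Real.exp (-a * |x - y|)
            + C * (2 / a) * Real.exp (-(a / 2) * |x - y|)) :=
          setIntegral_le_integral hint (ae_of_all _ fun y => by positivity)
      _ = _ := by
          rw [integral_add ((hexp a ha).const_mul ε)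
            ((hexp (a / 2) (by positivity)).const_mul (C * (2 / a))), integral_const_mul,
            integral_const_mul, hexpi a ha, hexpi (a / 2) (by positivity)]
  have h4 : |e x * Real.exp (-a * x)| ≤ ε + C / a := by
    have h5 := hmod x 0 hx le_rfl
    rw [h0, sub_zero, sub_zero, abs_of_nonneg hx] at h5
    rw [abs_mul, abs_of_pos (Real.exp_pos _)]
    have h6 : Real.exp (-a * x) ≤ 1 := Real.exp_le_one_iff.2 (by nlinarith)
    calc _ ≤ (ε + C * x) * Real.exp (-a * x) := by gcongr
      _ = ε * Real.exp (-a * x) + C * (x * Real.exp (-a * x)) := by ring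
      _ ≤ ε * 1 + C * (1 / a) := by gcongr; exact mul_exp_neg_mul_le ha
      _ = ε + C / a := by ring
  have h5 : |lam / a * I| ≤ ε + 4 * C / a := by
    rw [abs_mul, abs_of_pos (by positivity)]
    calc _ ≤ lam / a * (ε * (2 / a) + C * (2 / a) * (2 / (a / 2))) := by gcongr
      _ = (2 * lam) / (a * a) * (ε + 4 * C / a) := by field_simp; ring
      _ = _ := by rw [hsq, div_self (by positivity), one_mul]
  rw [h2]
  refine (abs_sub _ _).trans ((add_le_add h5 h4).trans_eq ?_)
  ring

end HalfLine

variable {k : ℕ}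

theorem exists_edge_modulus (g : C(StarGraph k, ℝ)) (i : Fin k) {ε : ℝ} (hε : 0 < ε) :
    ∃ C, 0 ≤ C ∧ ∀ x y, 0 ≤ x → 0 ≤ y → |edge g i x - edge g i y| ≤ ε + C * |x - y| := by
  -- The absolute value gives the same limit at both ends of `ℝ`, whence uniform continuity. Beyond
  -- distance `η` the slope `2‖g‖/η` covers the largest possible oscillation.
  have huc : UniformContinuous fun x : ℝ => edge g i |x| := by
    refine Continuous.uniformContinuous_of_tendsto_cocompact (x := g (mk i ⊤))
      ((continuous_edge g i).comp continuous_abs) ?_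
    exact (tendsto_edge g i).comp (tendsto_norm_cocompact_atTop (E := ℝ))
  obtain ⟨η, hη, h⟩ := Metric.uniformContinuous_iff.1 huc ε hε
  refine ⟨2 * ‖g‖ / η, by positivity, fun x y hx hy => ?_⟩
  rcases lt_or_ge |x - y| η with h1 | h1
  · have h2 := h (a := x) (b := y) h1
    simp only [abs_of_nonneg hx, abs_of_nonneg hy, Real.dist_eq] at h2
    have : 0 ≤ 2 * ‖g‖ / η * |x - y| := by positivity
    linarith
  · have h2 : |edge g i x - edge g i y| ≤ 2 * ‖g‖ :=
      (abs_sub _ _).trans (by linarith [abs_edge_le g i x, abs_edge_le g i y])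
    have h3 : 2 * ‖g‖ ≤ 2 * ‖g‖ / η * |x - y| := by
      rw [div_mul_eq_mul_div, le_div_iff₀ hη]
      gcongr
    linarith

end StarGraph

/-! ### Contractivity and semigroups for sub-Markov pseudo-resolvents -/

section SubMarkov

variable {X : Type*} [TopologicalSpace X] [CompactSpace X] {R : ℝ → C(X, ℝ) →L[ℝ] C(X, ℝ)}

/-- Apply positivity to `‖f‖·1 - f` and use `λ R_λ 1 ≤ 1`; the lower bound is the same for `-f`. -/
theorem IsSubMarkovPseudoResolvent.norm_smul_le (hR : IsSubMarkovPseudoResolvent R) {lam : ℝ}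
    (hl : 0 < lam) (f : C(X, ℝ)) : ‖lam • R lam f‖ ≤ ‖f‖ := by
  have key : ∀ f : C(X, ℝ), ∀ x, lam * R lam f x ≤ ‖f‖ := by
    intro f x
    have h1 : 0 ≤ R lam (‖f‖ • (1 : C(X, ℝ)) - f) := hR.nonneg lam hl _ (fun y => by
      have := (le_abs_self _).trans (f.norm_coe_le_norm y)
      simpa using this)
    rw [map_sub, map_smul] at h1
    have h2 : 0 ≤ ‖f‖ * R lam 1 x - R lam f x := h1 x
    have h3 : lam * R lam 1 x ≤ 1 := hR.le_one lam hl x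
    have h4 := mul_le_mul_of_nonneg_left h3 (norm_nonneg f)
    nlinarith
  refine (ContinuousMap.norm_le _ (norm_nonneg f)).2 fun x => abs_le.2 ⟨?_, key f x⟩
  have h1 := key (-f) x
  simp only [map_neg, norm_neg, ContinuousMap.neg_apply] at h1
  simp only [ContinuousMap.smul_apply, smul_eq_mul]
  linarith

/-- A sub-Markov pseudo-resolvent with range in `E` that is strongly continuous on `E` is the
Laplace transform of exactly one semigroup on `E`. -/
theorem IsSubMarkovPseudoResolvent.exists_semigroup (hR : IsSubMarkovPseudoResolvent R)
    {E : Submodule ℝ C(X, ℝ)} [CompleteSpace E] (hRE : ∀ lam g, R lam g ∈ E)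
    (hlim : ∀ g ∈ E, Tendsto (fun lam : ℝ => lam • R lam g) atTop (𝓝 g)) :
    ∃ T : ℝ≥0 → E →L[ℝ] E, (IsPositiveContractionSemigroup T ∧ IsLaplaceTransform R T) ∧
      (∀ T' : ℝ≥0 → E →L[ℝ] E, IsPositiveContractionSemigroup T' → IsLaplaceTransform R T' →
        T' = T) ∧
      ∀ g : E, (∀ lam, 0 < lam → lam • R lam (g : C(X, ℝ)) = g) → ∀ t, T t g = g := by
  obtain ⟨T, h0, hadd, hcont, hle, hL, huniq, hmem⟩ := exists_semigroup_submodule hR.hilbert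
    (fun lam hl => hR.norm_smul_le hl) hRE hlim
  refine ⟨T, ⟨⟨h0, hadd, hcont, fun t g hg => ?_, hle⟩, hL⟩, fun T' hT' hL' =>
    huniq T' hT'.zero hT'.add hT'.continuous hT'.contraction hL', fun g hg t => ?_⟩
  · refine hmem {f | 0 ≤ f} (convex_Ici (𝕜 := ℝ) (0 : C(X, ℝ))) ?_
      (fun lam hl f hf => smul_nonneg hl.le (hR.nonneg lam hl f hf)) t g hg
    have h : {f : C(X, ℝ) | 0 ≤ f} = ⋂ x, {f : C(X, ℝ) | 0 ≤ f x} := by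
      ext f
      simp [ContinuousMap.le_def]
    rw [h]
    exact isClosed_iInter fun x => isClosed_le continuous_const (continuous_eval_const x)
  · exact Subtype.ext (hmem {(g : C(X, ℝ))} (convex_singleton _) isClosed_singleton
      (fun lam hl f hf => by
        rw [mem_singleton_iff] at hf ⊢
        rw [hf]
        exact hg lam hl) t g rfl)

end SubMarkov

namespace StarGraph

variable {k : ℕ}

/-! ### The minimal resolvent -/

theorem lifetimeLaplace_nonneg {lam : ℝ} (hl : 0 < lam) (s : StarGraph k) :
    0 ≤ lifetimeLaplace lam s := by
  obtain ⟨i, x, rfl⟩ := exists_mk s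
  rw [lifetimeLaplace_apply hl]
  split_ifs
  · exact le_rfl
  · exact (Real.exp_pos _).le

theorem lifetimeLaplace_le_one {lam : ℝ} (hl : 0 < lam) (s : StarGraph k) :
    lifetimeLaplace lam s ≤ 1 := by
  obtain ⟨i, x, rfl⟩ := exists_mk s
  rw [lifetimeLaplace_apply hl]
  split_ifs
  · exact zero_le_one
  · refine Real.exp_le_one_iff.2 ?_
    have := mul_nonneg (Real.sqrt_nonneg (2 * lam)) (ENNReal.toReal_nonneg (a := x))
    linarith

theorem lifetimeLaplace_center [NeZero k] {lam : ℝ} (hl : 0 < lam) :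
    lifetimeLaplace lam (center : StarGraph k) = 1 := by
  rw [center, lifetimeLaplace_apply hl]
  simp

theorem eq_center_of_lifetimeLaplace_eq_one [NeZero k] {lam : ℝ} (hl : 0 < lam) {s : StarGraph k}
    (hs : lifetimeLaplace lam s = 1) : s = center := by
  obtain ⟨i, x, rfl⟩ := exists_mk s
  rw [lifetimeLaplace_apply hl] at hs
  split_ifs at hs with hx
  · exact absurd hs zero_ne_one
  · rw [Real.exp_eq_one_iff] at hs
    have ha : -√(2 * lam) ≠ 0 := neg_ne_zero.2 (by positivity)
    have h0 : x.toReal = 0 := (mul_eq_zero.1 hs).resolve_left ha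
    rw [(ENNReal.toReal_eq_zero_iff x).1 h0 |>.resolve_right hx, mk_zero_eq_center]

theorem tendsto_lifetimeLaplace [NeZero k] {s : StarGraph k} (hs : s ≠ center) :
    Tendsto (fun lam => lifetimeLaplace lam s) atTop (𝓝 0) := by
  obtain ⟨i, x, rfl⟩ := exists_mk s
  by_cases hx : x = ⊤
  · refine tendsto_const_nhds.congr' ?_
    filter_upwards [eventually_gt_atTop 0] with lam hl
    rw [lifetimeLaplace_apply hl, if_pos hx]
  · have hx0 : 0 < x.toReal := ENNReal.toReal_pos (fun h => hs (by rw [h, mk_zero_eq_center])) hx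
    have h1 : Tendsto (fun lam : ℝ => Real.exp (-(√(2 * lam) * x.toReal))) atTop (𝓝 0) :=
      Real.tendsto_exp_atBot.comp (tendsto_neg_atTop_atBot.comp
        ((Real.tendsto_sqrt_atTop.comp (tendsto_id.const_mul_atTop two_pos)).atTop_mul_const hx0))
    refine h1.congr' ?_
    filter_upwards [eventually_gt_atTop 0] with lam hl
    rw [lifetimeLaplace_apply hl, if_neg hx, neg_mul]

theorem minRes_center [NeZero k] {lam : ℝ} (hl : 0 < lam) (g : C(StarGraph k, ℝ)) :
    minRes lam g center = 0 := by
  rw [center, minRes_apply hl]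
  simp [minResHalfLine_zero]

theorem minRes_nonneg {lam : ℝ} (hl : 0 < lam) {g : C(StarGraph k, ℝ)} (hg : 0 ≤ g)
    (s : StarGraph k) : 0 ≤ minRes lam g s := by
  obtain ⟨i, x, rfl⟩ := exists_mk s
  rw [minRes_apply hl]
  split_ifs
  · exact div_nonneg (hg _) hl.le
  · exact minResHalfLine_nonneg hl (fun y => hg _) ENNReal.toReal_nonneg

theorem mul_minRes_one {lam : ℝ} (hl : 0 < lam) (s : StarGraph k) :
    lam * minRes lam 1 s = 1 - lifetimeLaplace lam s := by
  obtain ⟨i, x, rfl⟩ := exists_mk s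
  rw [minRes_apply hl, lifetimeLaplace_apply hl]
  split_ifs
  · simp [hl.ne']
  · have h : edge (1 : C(StarGraph k, ℝ)) i = fun _ => 1 := rfl
    rw [h, minResHalfLine_one hl ENNReal.toReal_nonneg]
    field_simp

theorem smul_minRes_one {lam : ℝ} (hl : 0 < lam) :
    lam • minRes lam (1 : C(StarGraph k, ℝ)) = 1 - lifetimeLaplace lam :=
  ContinuousMap.ext (mul_minRes_one hl)

theorem minRes_hilbert {lam nu : ℝ} (hl : 0 < lam) (hn : 0 < nu) (g : C(StarGraph k, ℝ)) :
    (lam - nu) • minRes nu (minRes lam g) = minRes nu g - minRes lam g := by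
  ext s
  obtain ⟨i, x, rfl⟩ := exists_mk s
  simp only [ContinuousMap.smul_apply, ContinuousMap.sub_apply, smul_eq_mul]
  rw [minRes_apply hn, minRes_apply hn, minRes_apply hl g i x]
  split_ifs
  · rw [minRes_apply hl, if_pos rfl]
    field_simp
  · refine minResHalfLine_hilbert hl hn (continuous_edge g i) (abs_edge_le g i)
      (continuous_edge _ i) (abs_edge_le _ i) (fun y hy => ?_) ENNReal.toReal_nonneg
    rw [edge, minRes_apply hl, if_neg ENNReal.ofReal_ne_top, ENNReal.toReal_ofReal hy]

/-- No new integral is needed: `ℓ_λ = 1 - λ R⁰_λ 1`, so this is the Hilbert equation applied to `1`.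
-/
theorem minRes_lifetimeLaplace {lam nu : ℝ} (hl : 0 < lam) (hn : 0 < nu) :
    (lam - nu) • minRes nu (lifetimeLaplace lam : C(StarGraph k, ℝ)) =
      lifetimeLaplace nu - lifetimeLaplace lam := by
  have h1 : (lifetimeLaplace lam : C(StarGraph k, ℝ)) = 1 - lam • minRes lam 1 := by
    rw [smul_minRes_one hl, sub_sub_cancel]
  have h2 : (lifetimeLaplace nu : C(StarGraph k, ℝ)) = 1 - nu • minRes nu 1 := by
    rw [smul_minRes_one hn, sub_sub_cancel]
  rw [h1, h2, map_sub, map_smul, smul_sub, smul_comm, minRes_hilbert hl hn]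
  module

/-- The half-line estimate is uniform in `x`, there are finitely many edges, and at infinity the
error is exactly zero. Vanishing at the center is necessary, since every `R⁰_λ g` vanishes there. -/
theorem tendsto_smul_minRes [NeZero k] {g : C(StarGraph k, ℝ)} (hg : g center = 0) :
    Tendsto (fun lam : ℝ => lam • minRes lam g) atTop (𝓝 g) := by
  rw [Metric.tendsto_nhds]
  intro ε hε
  choose C hC0 hC using fun i => exists_edge_modulus g i (show 0 < ε / 6 by positivity)
  have h1 : ∀ i, ∀ᶠ lam : ℝ in atTop, 5 * C i / √(2 * lam) < ε / 3 := fun i =>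
    ((Real.tendsto_sqrt_atTop.comp (tendsto_id.const_mul_atTop two_pos)).const_div_atTop
      (5 * C i)).eventually_lt_const (by positivity)
  filter_upwards [eventually_all.2 h1, eventually_gt_atTop 0] with lam h2 hl
  rw [dist_eq_norm, ContinuousMap.norm_lt_iff _ hε]
  intro s
  obtain ⟨i, x, rfl⟩ := exists_mk s
  rw [ContinuousMap.sub_apply, ContinuousMap.smul_apply, smul_eq_mul, minRes_apply hl]
  split_ifs with hx
  · rw [hx, mul_div_cancel₀ _ hl.ne', sub_self, norm_zero]
    exact hε
  · have h0 : edge g i 0 = 0 := by rw [edge, ENNReal.ofReal_zero, mk_zero_eq_center, hg]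
    have h3 := abs_mul_minResHalfLine_sub_le hl (continuous_edge g i) (abs_edge_le g i) h0
      (by positivity) (hC0 i) (hC i) (ENNReal.toReal_nonneg (a := x))
    have h4 : edge g i x.toReal = g (mk i x) := by rw [edge, ENNReal.ofReal_toReal hx]
    rw [h4] at h3
    refine h3.trans_lt ?_
    linarith [h2 i]

/-! ### The resolvent without local boundary terms -/

section Jump

variable {γ : ℝ} {m : Measure (StarGraph k)} [IsFiniteMeasure m]

theorem integralFunctional_nonneg {g : C(StarGraph k, ℝ)} (hg : ∀ s, 0 ≤ g s) :
    0 ≤ integralFunctional m g :=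
  integral_nonneg hg

variable [NeZero k]

theorem boundaryFunctional_zero (lam : ℝ) :
    boundaryFunctional (0 : ℝ) (0 : Fin k → ℝ) lam = 0 := by
  simp [boundaryFunctional]

theorem entranceFunctional_apply {lam : ℝ} (hl : 0 < lam) (g : C(StarGraph k, ℝ)) :
    entranceFunctional 0 0 γ m lam g =
      integralFunctional m (minRes lam g) /
        (γ + integralFunctional m 1 - integralFunctional m (lifetimeLaplace lam)) := by
  have h1 : lam * ∫ s, minRes lam (1 : C(StarGraph k, ℝ)) s ∂m =
      integralFunctional m 1 - integralFunctional m (lifetimeLaplace lam) := by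
    rw [← map_sub, ← smul_minRes_one hl, map_smul, smul_eq_mul, integralFunctional_apply]
  simp [entranceFunctional, boundaryFunctional_zero, h1, add_sub_assoc, div_eq_inv_mul]

/-- The default value for `λ ≤ 0` keeps the range in the subspace for every real `λ`, as the
semigroup theorem requires. -/
theorem resolventFormula_of_nonpos {lam : ℝ} (hl : ¬ 0 < lam) (g : C(StarGraph k, ℝ)) :
    resolventFormula 0 0 γ m lam g = 0 := by
  rw [resolventFormula_apply, minRes, lifetimeLaplace, dif_neg hl, dif_neg hl]
  simp

/-- Equality would force `ℓ_λ = 1` almost everywhere, hence `m` concentrated at the center. The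
strictness keeps the denominator positive even for `γ = 0`. -/
theorem integralFunctional_lifetimeLaplace_lt (hm : m ≠ 0) (hm0 : m {center} = 0) {lam : ℝ}
    (hl : 0 < lam) : integralFunctional m (lifetimeLaplace lam) < integralFunctional m 1 := by
  rw [← sub_pos, ← map_sub]
  have h0 : ∀ s, 0 ≤ (1 - lifetimeLaplace lam : C(StarGraph k, ℝ)) s := fun s =>
    sub_nonneg.2 (lifetimeLaplace_le_one hl s)
  refine (integralFunctional_nonneg h0).lt_of_ne' fun h => hm ?_
  rw [integralFunctional_apply, integral_eq_zero_iff_of_nonneg h0 (integrable_of_continuous m _)] at h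
  rw [← Measure.measure_univ_eq_zero, ← hm0]
  refine measure_congr ?_
  have hc : ∀ᵐ s ∂m, s ≠ center := measure_eq_zero_iff_ae_notMem.1 hm0
  filter_upwards [h, hc] with s hs hsc
  exact absurd (eq_center_of_lifetimeLaplace_eq_one hl (sub_eq_zero.1 hs).symm) hsc

theorem tendsto_integralFunctional_lifetimeLaplace (hm0 : m {center} = 0) :
    Tendsto (fun lam => integralFunctional m (lifetimeLaplace lam)) atTop (𝓝 0) := by
  have h := tendsto_integral_filter_of_dominated_convergence (μ := m) (l := atTop)
    (F := fun (lam : ℝ) s => lifetimeLaplace lam s) (f := fun _ => 0) (fun _ => 1)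
    (Eventually.of_forall fun lam => (lifetimeLaplace lam).continuous.aestronglyMeasurable)
    (by
      filter_upwards [eventually_gt_atTop 0] with lam hl
      refine ae_of_all _ fun s => ?_
      rw [Real.norm_of_nonneg (lifetimeLaplace_nonneg hl s)]
      exact lifetimeLaplace_le_one hl s)
    (integrable_const _) (by
      have hc : ∀ᵐ s ∂m, s ≠ center := measure_eq_zero_iff_ae_notMem.1 hm0
      filter_upwards [hc] with s hs using tendsto_lifetimeLaplace hs)
  simpa [integralFunctional_apply] using h

theorem isSubMarkovPseudoResolvent_resolventFormula (hγ : 0 ≤ γ) (hm : m ≠ 0)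
    (hm0 : m {center} = 0) : IsSubMarkovPseudoResolvent (resolventFormula 0 0 γ m) where
  nonneg lam hl g hg s := by
    have hD := integralFunctional_lifetimeLaplace_lt hm hm0 hl
    rw [resolventFormula_apply, entranceFunctional_apply hl]
    exact add_nonneg (minRes_nonneg hl hg s) (mul_nonneg
      (div_nonneg (integralFunctional_nonneg (minRes_nonneg hl hg)) (by linarith))
      (lifetimeLaplace_nonneg hl s))
  hilbert lam nu hl hn := by
    have hDl := integralFunctional_lifetimeLaplace_lt hm hm0 hl
    have hDn := integralFunctional_lifetimeLaplace_lt hm hm0 hn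
    ext g s
    have h1 := minRes_hilbert hl hn g
    have h2 := minRes_lifetimeLaplace (k := k) hl hn
    have h3 := congrArg (integralFunctional m) h1
    have h4 := congrArg (integralFunctional m) h2
    have h5 := DFunLike.congr_fun h1 s
    have h6 := DFunLike.congr_fun h2 s
    simp only [smul_apply, sub_apply, ContinuousLinearMap.comp_apply, resolventFormula_apply,
      entranceFunctional_apply hl, entranceFunctional_apply hn, map_add, map_sub, map_smul,
      ContinuousMap.add_apply, ContinuousMap.sub_apply, ContinuousMap.smul_apply,
      smul_eq_mul] at h3 h4 h5 h6 ⊢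
    set Dl := γ + integralFunctional m 1 - integralFunctional m (lifetimeLaplace lam) with hDl'
    set Dn := γ + integralFunctional m 1 - integralFunctional m (lifetimeLaplace nu) with hDn'
    have hDl0 : Dl ≠ 0 := by linarith
    have hDn0 : Dn ≠ 0 := by linarith
    -- This difference of denominators cancels the cross term of the two rank-one parts.
    have h4' : (lam - nu) * integralFunctional m (minRes nu (lifetimeLaplace lam)) = Dl - Dn := by
      rw [h4, hDl', hDn']; ring
    field_simp
    linear_combination (Dl * Dn) * h5 + Dn * (integralFunctional m (minRes lam g)) * h6 +
      Dl * (lifetimeLaplace nu s) * h3 +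
      (integralFunctional m (minRes lam g)) * (lifetimeLaplace nu s) * h4'
  le_one lam hl s := by
    have hD := integralFunctional_lifetimeLaplace_lt hm hm0 hl
    have h1 := mul_minRes_one hl s
    have h2 := congrArg (integralFunctional m) (smul_minRes_one (k := k) hl)
    rw [map_smul, map_sub, smul_eq_mul] at h2
    change lam * (minRes lam 1 s + entranceFunctional 0 0 γ m lam 1 * lifetimeLaplace lam s) ≤ 1
    rw [entranceFunctional_apply hl, mul_add, h1, ← mul_assoc, ← mul_div_assoc, h2]
    have h3 : (integralFunctional m 1 - integralFunctional m (lifetimeLaplace lam)) /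
        (γ + integralFunctional m 1 - integralFunctional m (lifetimeLaplace lam)) ≤ 1 :=
      (div_le_one (by linarith)).2 (by linarith)
    nlinarith [lifetimeLaplace_nonneg hl s]

theorem smul_resolventFormula_one (hm : m ≠ 0) (hm0 : m {center} = 0) {lam : ℝ} (hl : 0 < lam) :
    lam • resolventFormula 0 0 0 m lam 1 = 1 := by
  have hD := integralFunctional_lifetimeLaplace_lt hm hm0 hl
  have h2 := congrArg (integralFunctional m) (smul_minRes_one (k := k) hl)
  rw [map_smul, map_sub, smul_eq_mul] at h2
  rw [resolventFormula_apply, entranceFunctional_apply hl, smul_add, smul_minRes_one hl, smul_smul,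
    ← mul_div_assoc, h2, zero_add, div_self (by linarith), one_smul, sub_add_cancel]

theorem integralFunctional_resolventFormula (hγ : 0 ≤ γ) (hm : m ≠ 0) (hm0 : m {center} = 0)
    (lam : ℝ) (g : C(StarGraph k, ℝ)) :
    integralFunctional m (resolventFormula 0 0 γ m lam g) =
      (γ + integralFunctional m 1) * resolventFormula 0 0 γ m lam g center := by
  by_cases hl : 0 < lam
  · have hD := integralFunctional_lifetimeLaplace_lt hm hm0 hl
    have hD0 : γ + integralFunctional m 1 - integralFunctional m (lifetimeLaplace lam) ≠ 0 := by
      linarith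
    rw [resolventFormula_apply, entranceFunctional_apply hl, map_add, map_smul,
      ContinuousMap.add_apply, ContinuousMap.smul_apply, minRes_center hl,
      lifetimeLaplace_center hl, smul_eq_mul, smul_eq_mul]
    field_simp
    ring
  · rw [resolventFormula_of_nonpos hl, map_zero, ContinuousMap.zero_apply, mul_zero]

theorem tendsto_smul_resolventFormula (hγ : 0 ≤ γ) (hm : m ≠ 0) (hm0 : m {center} = 0)
    {g : C(StarGraph k, ℝ)}
    (hg : integralFunctional m g = (γ + integralFunctional m 1) * g center) :
    Tendsto (fun lam : ℝ => lam • resolventFormula 0 0 γ m lam g) atTop (𝓝 g) := by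
  obtain ⟨h, hh⟩ : ∃ h : C(StarGraph k, ℝ), h = g - g center • 1 := ⟨_, rfl⟩
  have hh0 : h center = 0 := by simp [hh]
  have hgh : g = h + g center • 1 := by rw [hh, sub_add_cancel]
  have hl0 := tendsto_integralFunctional_lifetimeLaplace hm0
  have hm1 : 0 < integralFunctional m (1 : C(StarGraph k, ℝ)) :=
    (integralFunctional_nonneg (lifetimeLaplace_nonneg one_pos)).trans_lt
      (integralFunctional_lifetimeLaplace_lt hm hm0 one_pos)
  have hmin := tendsto_smul_minRes hh0
  have hI : Tendsto (fun lam : ℝ => integralFunctional m (lam • minRes lam h)) atTop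
      (𝓝 (integralFunctional m h)) := ((integralFunctional m).continuous.tendsto h).comp hmin
  set c : ℝ → ℝ := fun lam => (integralFunctional m (lam • minRes lam h) + g center *
    (integralFunctional m 1 - integralFunctional m (lifetimeLaplace lam))) /
      (γ + integralFunctional m 1 - integralFunctional m (lifetimeLaplace lam)) with hc
  -- The limit is `m(g) / (γ + m(1))`, which is `g(0)` precisely by the condition on `g`.
  have hclim : Tendsto c atTop (𝓝 (g center)) := by
    have h1 := (hI.add ((hl0.const_sub (integralFunctional m 1)).const_mul (g center))).div
      (hl0.const_sub (γ + integralFunctional m 1)) (by linarith)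
    have h2 : (integralFunctional m h + g center * (integralFunctional m 1 - 0)) /
        (γ + integralFunctional m 1 - 0) = g center := by
      rw [div_eq_iff (by linarith), hh, map_sub, map_smul, hg, smul_eq_mul]
      ring
    rwa [h2] at h1
  -- Since `λ R⁰_λ 1 = 1 - ℓ_λ`, the constant part of `g` is reproduced up to a multiple of `ℓ_λ`.
  -- As `ℓ_λ` does not tend to zero in norm, its coefficient must.
  have hres : ∀ lam, 0 < lam → lam • resolventFormula 0 0 γ m lam g =
      lam • minRes lam h + g center • 1 + (c lam - g center) • lifetimeLaplace lam := by
    intro lam hl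
    have h1 : lam • minRes lam g = lam • minRes lam h + g center • (1 - lifetimeLaplace lam) := by
      have h2 := congrArg (minRes lam) hgh
      rw [map_add, map_smul] at h2
      rw [h2, smul_add, smul_comm lam (g center), smul_minRes_one hl]
    have h2 : lam * entranceFunctional 0 0 γ m lam g = c lam := by
      rw [entranceFunctional_apply hl, ← mul_div_assoc, ← smul_eq_mul, ← map_smul, h1, map_add,
        map_smul _ (g center), map_sub, smul_eq_mul]
    rw [resolventFormula_apply, smul_add, h1, smul_smul, h2]
    module
  have h3 : Tendsto (fun lam => (c lam - g center) • (lifetimeLaplace lam : C(StarGraph k, ℝ)))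
      atTop (𝓝 0) := by
    have h4 : Tendsto (fun lam => ‖c lam - g center‖) atTop (𝓝 0) := by
      simpa using (hclim.sub_const (g center)).norm
    refine squeeze_zero_norm' ?_ h4
    filter_upwards [eventually_gt_atTop 0] with lam hl
    rw [norm_smul]
    refine mul_le_of_le_one_right (norm_nonneg _) ((ContinuousMap.norm_le _ zero_le_one).2 fun s => ?_)
    rw [Real.norm_of_nonneg (lifetimeLaplace_nonneg hl s)]
    exact lifetimeLaplace_le_one hl s
  have h5 := (hmin.add_const (g center • 1)).add h3
  rw [← hgh, add_zero] at h5
  refine h5.congr' ?_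
  filter_upwards [eventually_gt_atTop 0] with lam hl
  rw [hres lam hl]

end Jump

/-! ### The subspace `C_F(S)` and the main theorem -/

theorem mem_kernelSpace [NeZero k] {γ : ℝ} {δ : ℝ≥0} {μ : Measure (StarGraph k)}
    [IsProbabilityMeasure μ] {g : C(StarGraph k, ℝ)} :
    g ∈ kernelSpace γ δ μ ↔ integralFunctional (δ • μ) g =
      (γ + integralFunctional (δ • μ) (1 : C(StarGraph k, ℝ))) * g center := by
  have h1 : ∀ f : C(StarGraph k, ℝ), integralFunctional (δ • μ) f = δ * ∫ s, f s ∂μ := fun f => by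
    rw [integralFunctional_apply, integral_smul_nnreal_measure, NNReal.smul_def, smul_eq_mul]
  have h2 : integralFunctional (δ • μ) (1 : C(StarGraph k, ℝ)) = δ := by
    rw [h1]; simp
  have h3 : kernelFunctional γ δ μ g = integralFunctional (δ • μ) g - (γ + δ) * g center := by
    rw [h1]; rfl
  rw [LinearMap.mem_ker, ContinuousLinearMap.coe_coe, h3, sub_eq_zero, h2]

end StarGraph

theorem proposition7p3 {k : ℕ} [NeZero k] (hk : 2 ≤ k)
    (α : ℝ) (β : Fin k → ℝ) (γ : ℝ) (δ : ℝ≥0) (μ : Measure (StarGraph k)) [IsProbabilityMeasure μ]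
    (hα : 0 ≤ α) (hβ : ∀ i, 0 ≤ β i) (hγ : 0 ≤ γ) (hδ : 0 < δ)
    (hμ0 : μ {StarGraph.center} = 0) (hμtop : ∀ i, μ {StarGraph.mk i ⊤} = 0)
    (hsing : α + ∑ i, β i = 0) :
    IsSubMarkovPseudoResolvent (StarGraph.resolventFormula α β γ (δ • μ)) ∧
    ¬ IsFellerResolvent (StarGraph.resolventFormula α β γ (δ • μ)) ∧
    (∀ lam, 0 < lam → ∀ g : C(StarGraph k, ℝ),
      StarGraph.resolventFormula α β γ (δ • μ) lam g ∈ StarGraph.kernelSpace γ δ μ) ∧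
    ∃ T : ℝ≥0 → StarGraph.kernelSpace γ δ μ →L[ℝ] StarGraph.kernelSpace γ δ μ,
      (IsPositiveContractionSemigroup T ∧
        IsLaplaceTransform (StarGraph.resolventFormula α β γ (δ • μ)) T) ∧
      (∀ T' : ℝ≥0 → StarGraph.kernelSpace γ δ μ →L[ℝ] StarGraph.kernelSpace γ δ μ,
        IsPositiveContractionSemigroup T' →
        IsLaplaceTransform (StarGraph.resolventFormula α β γ (δ • μ)) T' → T' = T) ∧
      ((∃ h1 : (1 : C(StarGraph k, ℝ)) ∈ StarGraph.kernelSpace γ δ μ,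
          ∀ t, T t ⟨1, h1⟩ = ⟨1, h1⟩) ↔ γ = 0) := by
  have hsum : 0 ≤ ∑ i, β i := Finset.sum_nonneg fun i _ => hβ i
  obtain rfl : α = 0 := by linarith
  obtain rfl : β = 0 := funext fun i =>
    (Finset.sum_eq_zero_iff_of_nonneg fun i _ => hβ i).1 (by linarith) i (Finset.mem_univ i)
  have hm0 : (δ • μ) {StarGraph.center} = 0 := by simp [hμ0]
  have hm : δ • μ ≠ 0 := smul_ne_zero hδ.ne' (IsProbabilityMeasure.ne_zero μ)
  have hR := StarGraph.isSubMarkovPseudoResolvent_resolventFormula hγ hm hm0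
  have hmem : ∀ lam g, StarGraph.resolventFormula 0 0 γ (δ • μ) lam g ∈
      StarGraph.kernelSpace γ δ μ := fun lam g =>
    StarGraph.mem_kernelSpace.2 (StarGraph.integralFunctional_resolventFormula hγ hm hm0 lam g)
  have hclosed : IsClosed (StarGraph.kernelSpace γ δ μ : Set C(StarGraph k, ℝ)) :=
    (StarGraph.kernelFunctional γ δ μ).isClosed_ker
  have : CompleteSpace (StarGraph.kernelSpace γ δ μ) := hclosed.completeSpace_coe
  have h1mem : (1 : C(StarGraph k, ℝ)) ∈ StarGraph.kernelSpace γ δ μ ↔ γ = 0 := by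
    rw [StarGraph.mem_kernelSpace]
    simp
  obtain ⟨T, hT, huniq, hfix⟩ := hR.exists_semigroup hmem fun g hg =>
    StarGraph.tendsto_smul_resolventFormula hγ hm hm0 (StarGraph.mem_kernelSpace.1 hg)
  refine ⟨hR, fun hF => ?_, fun lam _ g => hmem lam g, T, hT, huniq,
    fun ⟨h1, _⟩ => h1mem.1 h1, fun h0 => ⟨h1mem.2 h0, fun t => hfix _ (fun lam hl => ?_) t⟩⟩
  -- The function `ℓ_1` witnesses the failure: it is `1` at the center but `m(ℓ_1) < m(1) ≤ γ +
  -- m(1)`, so it is outside the closed subspace containing all `λ R_λ ℓ_1`.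
  · have h1 := hclosed.mem_of_tendsto (hF.tendsto (StarGraph.lifetimeLaplace 1))
      (Eventually.of_forall fun lam => Submodule.smul_mem _ _ (hmem lam _))
    have h2 := StarGraph.mem_kernelSpace.1 h1
    have h3 := StarGraph.integralFunctional_lifetimeLaplace_lt hm hm0 one_pos
    rw [StarGraph.lifetimeLaplace_center one_pos, mul_one] at h2
    linarith
  · subst h0
    exact StarGraph.smul_resolventFormula_one hm hm0 hl
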